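/- For a finite graph $K=(V,E)$ write $f(K)=3|V|-|E|$. A finite graph $G$ is $(3,6)$-sparse if $f(K)\ge 6$ for every subgraph $K$ of $G$ with at least three vertices, and $(3,6)$-tight if in addition $f(G)=6$. A triangulation of a compact bordered surface $S$ (a compact connected Hausdorff space that is a topological 2-manifold, possibly with boundary) is a finite simplicial complex whose geometric realization is homeomorphic to $S$; thus it is connected, pure of dimension 2, each edge lies in one or two triangles, and each vertex link is a path or a cycle. Its graph is its 1-skeleton. The local barycentric subdivision move on an edge $uv$ lying in two triangles $uvx$, $uvy$ inserts a new vertex $m$ in the edge $uv$ and new vertices $b$, $c$ in the triangles $uvx$, $uvy$, joins $b$ to $u,m,v,x$ and $c$ to $u,m,v,y$, and thus replaces the edge $uv$ by three new vertices and ten new edges. \textbf{Lemma.} Let $S$ be a compact bordered surface and let $G$ be a triangulation of $S$ whose graph satisfies $f(G)=6$. Then for some $n\ge 0$ there is a sequence of $n$ local barycentric subdivision moves that starts from $G$ and ends in a triangulation $G'$ of $S$ whose graph is $(3,6)$-tight. -/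

import Mathlib

/-- A finite graph's Maxwell count `f(G) = 3|V| - |E|`. -/
noncomputable def maxwellCount {W : Type*} (G : SimpleGraph W) : ℤ :=
  3 * (Nat.card W : ℤ) - (G.edgeSet.ncard : ℤ)

/-- The Maxwell count `3|V'| - |E'|` of a (finite) subgraph `G' = (V', E')` of `G`. -/
noncomputable def subgraphMaxwellCount {W : Type*} {G : SimpleGraph W} (G' : G.Subgraph) : ℤ :=
  3 * (G'.verts.ncard : ℤ) - (G'.edgeSet.ncard : ℤ)

/-- A finite graph is `(3,6)`-sparse if `f(G') ≥ 6` for each subgraph `G'` (not necessarily induced)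
with at least three vertices. -/
def IsSparse36 {W : Type*} (G : SimpleGraph W) : Prop :=
  Finite W ∧ ∀ G' : G.Subgraph, 3 ≤ G'.verts.ncard → 6 ≤ subgraphMaxwellCount G'

/-- A finite graph is `(3,6)`-tight if it is `(3,6)`-sparse and `f(G) = 6`. -/
def IsTight36 {W : Type*} (G : SimpleGraph W) : Prop :=
  IsSparse36 G ∧ maxwellCount G = 6

/-- A finite pure two-dimensional abstract simplicial complex with vertices in `V`, given by its
triangles. Its simplices are the nonempty subsets of the triangles. -/
@[ext]
structure TriComplex (V : Type*) where
  triangles : Finset (Finset V)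
  card_eq_three : ∀ t ∈ triangles, t.card = 3

namespace TriComplex

variable {V : Type*}

/-- The vertex set. -/
def verts (K : TriComplex V) : Set V := {v | ∃ t ∈ K.triangles, v ∈ t}

/-- The graph of vertices and edges, on the ambient type `V` (every point outside `K.verts` is
isolated). -/
def ambientGraph (K : TriComplex V) : SimpleGraph V where
  Adj v w := v ≠ w ∧ ∃ t ∈ K.triangles, v ∈ t ∧ w ∈ t
  symm := ⟨fun _ _ h => ⟨h.1.symm, h.2.imp fun _ ht => ⟨ht.1, ht.2.2, ht.2.1⟩⟩⟩
  loopless := ⟨fun _ h => h.1 rfl⟩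

/-- The graph (1-skeleton) of the complex: its vertex type is exactly the vertex set. -/
def graph (K : TriComplex V) : SimpleGraph K.verts := K.ambientGraph.induce K.verts

/-- The link of the vertex `v`: its vertices are the neighbours `w` of `v`, and `w`, `w'` are
adjacent when `v`, `w`, `w'` are the vertices of a triangle. -/
def link (K : TriComplex V) (v : V) : SimpleGraph (K.ambientGraph.neighborSet v) where
  Adj w w' := w ≠ w' ∧ ∃ t ∈ K.triangles, v ∈ t ∧ (w : V) ∈ t ∧ (w' : V) ∈ t
  symm := ⟨fun _ _ h => ⟨h.1.symm, h.2.imp fun _ ht => ⟨ht.1, ht.2.1, ht.2.2.2, ht.2.2.1⟩⟩⟩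
  loopless := ⟨fun _ h => h.1 rfl⟩

/-- `K` is a combinatorial bordered surface: it is connected, every edge lies in one or two
triangles, and the link of every vertex is connected. As the degree of `w` in the link of `v` is the
number of triangles on the edge `vw`, the links are exactly paths (at boundary vertices) and
cycles (at interior vertices). -/
structure IsBorderedSurface (K : TriComplex V) : Prop where
  connected : K.graph.Connected
  edge_le_two : ∀ v w : V, v ≠ w → {t | t ∈ K.triangles ∧ v ∈ t ∧ w ∈ t}.ncard ≤ 2
  link_connected : ∀ v ∈ K.verts, (K.link v).Connected

/-- The geometric realization: the convex combinations of the vertices whose support lies in a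
triangle, as a subspace of `V → ℝ`. -/
def realization (K : TriComplex V) : Set (V → ℝ) :=
  {p | (∀ v, 0 ≤ p v) ∧ ∃ t ∈ K.triangles, (∀ v, v ∉ t → p v = 0) ∧ ∑ v ∈ t, p v = 1}

/-- `K` is a triangulation of the bordered surface `S`. -/
def Triangulates (K : TriComplex V) (S : Type*) [TopologicalSpace S] : Prop :=
  K.IsBorderedSurface ∧ Nonempty (K.realization ≃ₜ S)

/-- `L` is obtained from `K` by the local barycentric subdivision move on an edge `uv` that lies in
two triangles `uvx` and `uvy`: a vertex `m` is inserted in the edge `uv`, vertices `b` and `c` are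
inserted in the triangles, `b` is joined to `u, m, v, x`, and `c` is joined to `u, m, v, y`. So the
edge `uv` gives way to three new vertices and ten new edges. -/
def LocalBarycentricMove [DecidableEq V] (K L : TriComplex V) : Prop :=
  ∃ u v x y m b c : V,
    x ≠ y ∧ ({u, v, x} : Finset V) ∈ K.triangles ∧ ({u, v, y} : Finset V) ∈ K.triangles ∧
    m ∉ K.verts ∧ b ∉ K.verts ∧ c ∉ K.verts ∧ m ≠ b ∧ m ≠ c ∧ b ≠ c ∧
    L.triangles = (K.triangles \ {{u, v, x}, {u, v, y}}) ∪
      {{u, m, b}, {m, v, b}, {v, x, b}, {x, u, b}, {u, m, c}, {m, v, c}, {v, y, c}, {y, u, c}}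

end TriComplex

/-! Since extra edges only lower the count, sparsity may be tested on induced subgraphs, that is, on
vertex sets `X` with at least three elements. Suppose the least count `k` is below 6, and call the
sets attaining it critical. A critical set spans an interior edge `uv` whose opposite vertices `x`,
`y` are not both in it (`exists_interior_edge`). Otherwise there are two cases. If `X` spans no
interior edge, then by the shape of vertex links it induces a graph of maximum degree two, so its
count is at least `2|X| ≥ 6`. If it does span one, connectedness of links and of the graph spreads
`X` over the whole vertex set, whose count is 6.

Apply the move to this `uv`. It adds three vertices and nine edges net, so the total count stays 6.
A set in the new complex has count at least that of its old part. Equality forces the three new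
vertices to lie in the set exactly when `u` and `v` do, and in that case `x` and `y` lie in it too
(`bool_change`, `of_inducedCount_eq`). Sets with fewer than three old vertices are harmless
(`six_le_inducedCount`). Hence the new critical sets inject into the old ones and miss the chosen
one (`card_criticalSets_lt`). Once no critical set is left, the lower bound rises by one; this ends
at 6 (`exists_reflTransGen`).

The surface is preserved because the move is a composite of three subdivisions of edges. Each of
these preserves the combinatorial surface conditions (`IsEdgeSubdiv.isBorderedSurface`) and the
realization up to homeomorphism (`realizationHomeomorph`). -/

/-- A graph is connected iff it is nonempty and every predicate that spreads along its edges is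
constant. -/
theorem SimpleGraph.connected_iff_forall_pred {W : Type*} (G : SimpleGraph W) :
    G.Connected ↔ Nonempty W ∧
      ∀ P : W → Prop, (∀ a b, G.Adj a b → P a → P b) → ∀ a b, P a → P b := by
  constructor
  · intro h
    refine ⟨h.nonempty, fun P hP a b ha => ?_⟩
    obtain ⟨w⟩ := h.preconnected a b
    induction w with
    | nil => exact ha
    | cons hadj _ ih => exact ih (hP _ _ hadj ha)
  · rintro ⟨hne, h⟩
    exact { preconnected := fun a b => h (G.Reachable a)
              (fun _ _ hcd hc => hc.trans hcd.reachable) a b (SimpleGraph.Reachable.refl a)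
            nonempty := hne }

/-! ### Surface conditions expressed through triangles. -/

namespace TriComplex

variable {V : Type*} [DecidableEq V]

/-- The points `a`, `b`, `c` are the vertices of a triangle of `K`. -/
def IsTriangle (K : TriComplex V) (a b c : V) : Prop := ({a, b, c} : Finset V) ∈ K.triangles

namespace IsTriangle

variable {K : TriComplex V} {a b c : V}

theorem rotate (h : K.IsTriangle a b c) : K.IsTriangle b c a := by
  unfold IsTriangle at *
  convert h using 1
  ext z; simp; tauto

theorem swap (h : K.IsTriangle a b c) : K.IsTriangle b a c := by
  unfold IsTriangle at *
  convert h using 1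
  ext z; simp; tauto

theorem ne (h : K.IsTriangle a b c) : a ≠ b ∧ a ≠ c ∧ b ≠ c := by
  have h3 := K.card_eq_three _ h
  refine ⟨?_, ?_, ?_⟩ <;> rintro rfl
  · have := Finset.card_le_two (a := a) (b := c)
    rw [Finset.insert_idem] at h3
    omega
  · have := Finset.card_le_two (a := b) (b := a)
    rw [Finset.insert_eq_of_mem (by simp)] at h3
    omega
  · have := Finset.card_le_two (a := a) (b := b)
    rw [Finset.pair_eq_singleton] at h3
    omega

theorem mem_verts (h : K.IsTriangle a b c) : a ∈ K.verts := ⟨_, h, by simp⟩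

end IsTriangle

variable {K L : TriComplex V}

theorem exists_isTriangle_of_mem {t : Finset V} (ht : t ∈ K.triangles) {v w : V} (hv : v ∈ t)
    (hw : w ∈ t) (hvw : v ≠ w) : ∃ z, K.IsTriangle v w z ∧ t = {v, w, z} := by
  have h3 := K.card_eq_three t ht
  have h1 : ((t.erase v).erase w).card = 1 := by
    rw [Finset.card_erase_of_mem (by simp [hw, hvw.symm]), Finset.card_erase_of_mem hv, h3]
  obtain ⟨z, hz⟩ := Finset.card_eq_one.1 h1
  have : t = {v, w, z} := by
    rw [← hz, Finset.insert_erase (by simp [hw, hvw.symm]), Finset.insert_erase hv]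
  exact ⟨z, by rwa [this] at ht, this⟩

theorem mem_verts_iff {v : V} : v ∈ K.verts ↔ ∃ a b, K.IsTriangle v a b := by
  constructor
  · rintro ⟨t, ht, hv⟩
    obtain ⟨w, hw, hwv⟩ := Finset.exists_mem_ne (by rw [K.card_eq_three t ht]; norm_num) v
    obtain ⟨z, hz, -⟩ := exists_isTriangle_of_mem ht hv hw hwv.symm
    exact ⟨w, z, hz⟩
  · rintro ⟨a, b, h⟩
    exact h.mem_verts

theorem ambientGraph_adj_iff {v w : V} : K.ambientGraph.Adj v w ↔ ∃ z, K.IsTriangle v w z := by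
  constructor
  · rintro ⟨hne, t, ht, hv, hw⟩
    obtain ⟨z, hz, -⟩ := exists_isTriangle_of_mem ht hv hw hne
    exact ⟨z, hz⟩
  · rintro ⟨z, h⟩
    exact ⟨h.ne.1, _, h, by simp, by simp⟩

theorem link_adj_iff {v : V} {w w' : K.ambientGraph.neighborSet v} :
    (K.link v).Adj w w' ↔ K.IsTriangle v w w' := by
  constructor
  · rintro ⟨hne, t, ht, hv, hw, hw'⟩
    obtain ⟨z, hz, rfl⟩ := exists_isTriangle_of_mem ht hv hw w.2.1
    simp only [Finset.mem_insert, Finset.mem_singleton] at hw'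
    rcases hw' with h | h | h
    · exact absurd h.symm w'.2.1
    · exact absurd (Subtype.ext h.symm) hne
    · rwa [h]
  · intro h
    exact ⟨fun e => h.ne.2.2 (by rw [e]), _, h, by simp, by simp, by simp⟩

/-- Every edge lies in a triangle, so predicates on the ambient type that spread along triangles
suffice. This form transfers between complexes without subtypes or walks. -/
theorem graph_connected_iff : K.graph.Connected ↔ K.verts.Nonempty ∧
    ∀ P : V → Prop, (∀ a b c, K.IsTriangle a b c → P a → P b) →
      ∀ a ∈ K.verts, ∀ b ∈ K.verts, P a → P b := by
  rw [SimpleGraph.connected_iff_forall_pred, Set.nonempty_coe_sort]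
  refine and_congr_right fun _ => ⟨fun h P hP a ha b hb => ?_, fun h P hP a b hPa => ?_⟩
  · refine h (fun w => P w) (fun c d hcd => ?_) ⟨a, ha⟩ ⟨b, hb⟩
    obtain ⟨z, hz⟩ := ambientGraph_adj_iff.1 hcd
    exact hP _ _ _ hz
  · refine (h (fun w => ∃ hw, P ⟨w, hw⟩) ?_ a a.2 b b.2 ⟨a.2, hPa⟩).2
    rintro c d e hT ⟨hc, hPc⟩
    exact ⟨hT.swap.mem_verts, hP ⟨c, hc⟩ _ (ambientGraph_adj_iff.2 ⟨e, hT⟩) hPc⟩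

theorem link_connected_iff {v : V} : (K.link v).Connected ↔ (∃ a b, K.IsTriangle v a b) ∧
    ∀ P : V → Prop, (∀ a b, K.IsTriangle v a b → P a → P b) →
      ∀ a b c d, K.IsTriangle v a b → K.IsTriangle v c d → P a → P c := by
  rw [SimpleGraph.connected_iff_forall_pred, Set.nonempty_coe_sort]
  refine and_congr ?_ ⟨fun h P hP a b c d hab hcd => ?_, fun h P hP a b hPa => ?_⟩
  · simp [Set.Nonempty, ambientGraph_adj_iff]
  · exact h (fun w => P w) (fun c d hcd => hP _ _ (link_adj_iff.1 hcd))
      ⟨a, ambientGraph_adj_iff.2 ⟨b, hab⟩⟩ ⟨c, ambientGraph_adj_iff.2 ⟨d, hcd⟩⟩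
  · obtain ⟨a', ha'⟩ := ambientGraph_adj_iff.1 a.2
    obtain ⟨b', hb'⟩ := ambientGraph_adj_iff.1 b.2
    refine (h (fun w => ∃ hw, P ⟨w, hw⟩) ?_ a a' b b' ha' hb' ⟨a.2, hPa⟩).2
    rintro c d hT ⟨hc, hPc⟩
    have hd : d ∈ K.ambientGraph.neighborSet v := ambientGraph_adj_iff.2 ⟨c, hT.swap.rotate⟩
    exact ⟨hd, hP ⟨c, hc⟩ ⟨d, hd⟩ (link_adj_iff.2 hT) hPc⟩

/-- A triangle on a given edge is determined by its third vertex, so the bound is a pigeonhole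
statement about third vertices. -/
theorem forall_ncard_le_two_iff :
    (∀ v w : V, v ≠ w → {t | t ∈ K.triangles ∧ v ∈ t ∧ w ∈ t}.ncard ≤ 2) ↔
      ∀ v w a b c, K.IsTriangle v w a → K.IsTriangle v w b → K.IsTriangle v w c →
        a = b ∨ a = c ∨ b = c := by
  constructor
  · intro h v w a b c ha hb hc
    by_contra! hne
    have hsub : (({{v, w, a}, {v, w, b}, {v, w, c}} : Finset (Finset V)) : Set (Finset V)) ⊆
        {t | t ∈ K.triangles ∧ v ∈ t ∧ w ∈ t} := by
      intro t ht
      simp only [Finset.coe_insert, Finset.coe_singleton, Set.mem_insert_iff,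
        Set.mem_singleton_iff] at ht
      rcases ht with rfl | rfl | rfl
      exacts [⟨ha, by simp, by simp⟩, ⟨hb, by simp, by simp⟩, ⟨hc, by simp, by simp⟩]
    have hfin : {t | t ∈ K.triangles ∧ v ∈ t ∧ w ∈ t}.Finite :=
      K.triangles.finite_toSet.subset fun t ht => ht.1
    have key : ∀ a b, K.IsTriangle v w a → K.IsTriangle v w b → a ≠ b →
        ({v, w, a} : Finset V) ≠ {v, w, b} := by
      intro a b ha hb hab he
      have : a ∈ ({v, w, b} : Finset V) := he ▸ by simp
      have := ha.ne
      simp at *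
      grind
    have h3 := Set.ncard_le_ncard hsub hfin
    rw [Set.ncard_coe_finset, Finset.card_eq_three.2 ⟨_, _, _, key _ _ ha hb hne.1,
      key _ _ ha hc hne.2.1, key _ _ hb hc hne.2.2, rfl⟩] at h3
    have := h v w ha.ne.1
    omega
  · intro h v w hvw
    by_contra! hc
    obtain ⟨t₁, t₂, t₃, h₁, h₂, h₃, h12, h13, h23⟩ := (Set.two_lt_ncard_iff
      (K.triangles.finite_toSet.subset fun t ht => ht.1)).1 hc
    obtain ⟨a, ha, rfl⟩ := exists_isTriangle_of_mem h₁.1 h₁.2.1 h₁.2.2 hvw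
    obtain ⟨b, hb, rfl⟩ := exists_isTriangle_of_mem h₂.1 h₂.2.1 h₂.2.2 hvw
    obtain ⟨c, hc, rfl⟩ := exists_isTriangle_of_mem h₃.1 h₃.2.1 h₃.2.2 hvw
    rcases h v w a b c ha hb hc with rfl | rfl | rfl
    exacts [h12 rfl, h13 rfl, h23 rfl]

/-! ### Subdivision of one edge. -/

/-- `L` arises from `K` by subdividing the edge `pq` with the new vertex `n`. -/
structure IsEdgeSubdiv (K L : TriComplex V) (p q n : V) : Prop where
  notMem : n ∉ K.verts
  exists_isTriangle : ∃ r, K.IsTriangle p q r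
  mem_iff : ∀ t, t ∈ L.triangles ↔ (t ∈ K.triangles ∧ ¬ (p ∈ t ∧ q ∈ t)) ∨
    ∃ r, K.IsTriangle p q r ∧ (t = {n, p, r} ∨ t = {n, q, r})

theorem exists_isEdgeSubdiv {p q n : V} (hn : n ∉ K.verts) (hpq : ∃ r, K.IsTriangle p q r) :
    ∃ L : TriComplex V, K.IsEdgeSubdiv L p q n := by
  classical
  obtain ⟨r₀, hr₀⟩ := hpq
  have hfin : {t : Finset V | (t ∈ K.triangles ∧ ¬ (p ∈ t ∧ q ∈ t)) ∨
      ∃ r, K.IsTriangle p q r ∧ (t = {n, p, r} ∨ t = {n, q, r})}.Finite := by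
    -- Each half of a split triangle is that triangle with `q` or `p` replaced by `n`.
    refine Set.Finite.subset ((K.triangles ∪ (K.triangles.image fun t => insert n (t.erase q)) ∪
      (K.triangles.image fun t => insert n (t.erase p))).finite_toSet) ?_
    rintro t (⟨ht, -⟩ | ⟨r, hr, rfl | rfl⟩)
    · simp [ht]
    · have := hr.ne
      simp only [Finset.coe_union, Finset.coe_image, Set.mem_union, Set.mem_image, Finset.mem_coe]
      exact Or.inl (Or.inr ⟨_, hr, by ext z; simp; grind⟩)
    · have := hr.ne
      simp only [Finset.coe_union, Finset.coe_image, Set.mem_union, Set.mem_image, Finset.mem_coe]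
      exact Or.inr ⟨_, hr, by ext z; simp; grind⟩
  refine ⟨⟨hfin.toFinset, fun t ht => ?_⟩, hn, ⟨r₀, hr₀⟩, fun t => by simp⟩
  rw [Set.Finite.mem_toFinset] at ht
  have hn' : ∀ z ∈ K.verts, n ≠ z := fun z hz e => hn (e ▸ hz)
  rcases ht with ⟨ht, -⟩ | ⟨r, hr, rfl | rfl⟩
  · exact K.card_eq_three t ht
  · exact Finset.card_eq_three.2 ⟨_, _, _, hn' _ hr.mem_verts, hn' _ hr.rotate.rotate.mem_verts,
      hr.ne.2.1, rfl⟩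
  · exact Finset.card_eq_three.2 ⟨_, _, _, hn' _ hr.rotate.mem_verts,
      hn' _ hr.rotate.rotate.mem_verts, hr.ne.2.2, rfl⟩

namespace IsEdgeSubdiv

variable {p q n : V}

theorem isTriangle_iff (h : K.IsEdgeSubdiv L p q n) {a b c : V} (ha : a ≠ n) (hb : b ≠ n)
    (hc : c ≠ n) : L.IsTriangle a b c ↔ K.IsTriangle a b c ∧
      ¬ ((a = p ∨ b = p ∨ c = p) ∧ (a = q ∨ b = q ∨ c = q)) := by
  have := h.mem_iff {a, b, c}
  unfold IsTriangle at *
  rw [this]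
  constructor
  · rintro (h | ⟨r, hr, e | e⟩)
    · simp at h; grind
    · have : n ∈ ({a, b, c} : Finset V) := e ▸ by simp
      simp at this; grind
    · have : n ∈ ({a, b, c} : Finset V) := e ▸ by simp
      simp at this; grind
  · intro h
    left
    simp
    grind

theorem isTriangle_iff_new (h : K.IsEdgeSubdiv L p q n) {a b : V} :
    L.IsTriangle n a b ↔
      (K.IsTriangle p q b ∧ (a = p ∨ a = q)) ∨ (K.IsTriangle p q a ∧ (b = p ∨ b = q)) := by
  have hn' : ∀ z ∈ K.verts, n ≠ z := fun z hz e => h.notMem (e ▸ hz)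
  constructor
  · intro ht
    have hne := ht.ne
    rcases (h.mem_iff _).1 ht with h' | ⟨r, hr, e⟩
    · exact absurd ⟨_, h'.1, by simp⟩ h.notMem
    · have h1 := hn' _ hr.mem_verts
      have h2 := hn' _ hr.rotate.mem_verts
      have h3 := hn' _ hr.rotate.rotate.mem_verts
      have h4 := hr.ne
      rcases e with e | e
      · have ha : a ∈ ({n, p, r} : Finset V) := e ▸ by simp
        have hb : b ∈ ({n, p, r} : Finset V) := e ▸ by simp
        simp only [Finset.mem_insert, Finset.mem_singleton] at ha hb
        grind
      · have ha : a ∈ ({n, q, r} : Finset V) := e ▸ by simp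
        have hb : b ∈ ({n, q, r} : Finset V) := e ▸ by simp
        simp only [Finset.mem_insert, Finset.mem_singleton] at ha hb
        grind
  · have key : ∀ a b, K.IsTriangle p q b → (a = p ∨ a = q) → L.IsTriangle n a b := by
      intro a b hb ha
      exact (h.mem_iff _).2 (Or.inr ⟨b, hb, by rcases ha with rfl | rfl <;> simp⟩)
    rintro (⟨hb, ha⟩ | ⟨hb, ha⟩)
    · exact key a b hb ha
    · exact (key b a hb ha).swap.rotate

end IsEdgeSubdiv

end TriComplex

/-! ### Edge subdivision preserves the surface conditions. -/

namespace TriComplex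

variable {V : Type*} [DecidableEq V] {K L : TriComplex V} {p q n : V}

namespace IsEdgeSubdiv

theorem isTriangle_of_ne_right (h : K.IsEdgeSubdiv L p q n) {a b c : V}
    (hT : K.IsTriangle a b c) (ha : a ≠ q) (hb : b ≠ q) (hc : c ≠ q) : L.IsTriangle a b c := by
  have hn' : ∀ z ∈ K.verts, z ≠ n := fun z hz e => h.notMem (e ▸ hz)
  exact (h.isTriangle_iff (hn' _ hT.mem_verts) (hn' _ hT.rotate.mem_verts)
    (hn' _ hT.rotate.rotate.mem_verts)).2 ⟨hT, by tauto⟩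

theorem verts_eq (h : K.IsEdgeSubdiv L p q n) : L.verts = insert n K.verts := by
  have hn' : ∀ z ∈ K.verts, z ≠ n := fun z hz e => h.notMem (e ▸ hz)
  obtain ⟨r, hr⟩ := h.exists_isTriangle
  have hnpr : L.IsTriangle n p r := h.isTriangle_iff_new.2 (Or.inl ⟨hr, Or.inl rfl⟩)
  have hnqr : L.IsTriangle n q r := h.isTriangle_iff_new.2 (Or.inl ⟨hr, Or.inr rfl⟩)
  ext v
  rw [Set.mem_insert_iff]
  constructor
  · intro hv
    by_cases hvn : v = n
    · exact Or.inl hvn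
    obtain ⟨a, b, hT⟩ := mem_verts_iff.1 hv
    right
    by_cases han : a = n
    · subst han
      rcases h.isTriangle_iff_new.1 hT.swap with ⟨h1, rfl | rfl⟩ | ⟨h1, -⟩
      exacts [h1.mem_verts, h1.rotate.mem_verts, h1.rotate.rotate.mem_verts]
    by_cases hbn : b = n
    · subst hbn
      rcases h.isTriangle_iff_new.1 hT.rotate.rotate with ⟨h1, rfl | rfl⟩ | ⟨h1, -⟩
      exacts [h1.mem_verts, h1.rotate.mem_verts, h1.rotate.rotate.mem_verts]
    exact ((h.isTriangle_iff hvn han hbn).1 hT).1.mem_verts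
  · rintro (rfl | hv)
    · exact hnpr.mem_verts
    · obtain ⟨a, b, hT⟩ := mem_verts_iff.1 hv
      by_cases hvp : v = p
      · exact hvp ▸ hnpr.rotate.mem_verts
      by_cases hvq : v = q
      · exact hvq ▸ hnqr.rotate.mem_verts
      by_cases hpq : (v = p ∨ a = p ∨ b = p) ∧ (v = q ∨ a = q ∨ b = q)
      · have hT' : K.IsTriangle p q v := by
          have := hT.ne
          have := hr.ne
          have h1 := hT.rotate
          have h2 := hT.rotate.swap
          grind
        exact (h.isTriangle_iff_new.2 (Or.inl ⟨hT', Or.inl rfl⟩)).rotate.rotate.mem_verts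
      · exact ((h.isTriangle_iff (hn' _ hv) (hn' _ hT.rotate.mem_verts)
          (hn' _ hT.rotate.rotate.mem_verts)).2 ⟨hT, hpq⟩).mem_verts

theorem symm (h : K.IsEdgeSubdiv L p q n) : K.IsEdgeSubdiv L q p n where
  notMem := h.notMem
  exists_isTriangle := h.exists_isTriangle.imp fun _ hr => hr.swap
  mem_iff t := by
    rw [h.mem_iff]
    have : ∀ r, K.IsTriangle p q r ↔ K.IsTriangle q p r := fun r => ⟨.swap, .swap⟩
    simp only [this]
    grind

theorem graph_connected (h : K.IsEdgeSubdiv L p q n) (hK : K.graph.Connected) :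
    L.graph.Connected := by
  have hn' : ∀ z ∈ K.verts, z ≠ n := fun z hz e => h.notMem (e ▸ hz)
  obtain ⟨r, hr⟩ := h.exists_isTriangle
  have hnpr : L.IsTriangle n p r := h.isTriangle_iff_new.2 (Or.inl ⟨hr, Or.inl rfl⟩)
  have hnqr : L.IsTriangle n q r := h.isTriangle_iff_new.2 (Or.inl ⟨hr, Or.inr rfl⟩)
  rw [graph_connected_iff] at hK ⊢
  rw [h.verts_eq]
  refine ⟨⟨n, by simp⟩, fun P hP => ?_⟩
  have hP' : ∀ a b c, L.IsTriangle a b c → (P a ↔ P b) ∧ (P a ↔ P c) := fun a b c hT =>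
    ⟨⟨hP _ _ _ hT, hP _ _ _ hT.swap⟩, ⟨hP _ _ _ hT.swap.rotate, hP _ _ _ hT.rotate.rotate⟩⟩
  have h1 := hP' _ _ _ hnpr
  have h2 := hP' _ _ _ hnqr
  have key := hK.2 P fun a b c hT => by
    -- A triangle on `pq` is gone from `L`, but `n` joins its three vertices there.
    by_cases hpq : (a = p ∨ b = p ∨ c = p) ∧ (a = q ∨ b = q ∨ c = q)
    · have : ∃ z, K.IsTriangle p q z ∧ (z = a ∨ z = b ∨ z = c) := by
        have h0 := hT.ne
        have h0' := hr.ne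
        have h3 := hT.swap
        have h4 := hT.rotate
        have h5 := hT.rotate.swap
        have h6 := hT.rotate.rotate
        have h7 := hT.rotate.rotate.swap
        grind
      obtain ⟨z, hz, hz'⟩ := this
      have h3 := hP' _ _ _ (h.isTriangle_iff_new.2 (Or.inl ⟨hz, Or.inl rfl⟩))
      have h0 := hT.ne
      have h4 := hz.ne
      grind
    · exact hP _ _ _ ((h.isTriangle_iff (hn' _ hT.mem_verts) (hn' _ hT.rotate.mem_verts)
        (hn' _ hT.rotate.rotate.mem_verts)).2 ⟨hT, hpq⟩)
  have hp := hr.mem_verts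
  have : ∀ a ∈ K.verts, (P a ↔ P p) := fun a ha => ⟨key a ha p hp, key p hp a ha⟩
  rintro a (rfl | ha) b (rfl | hb) <;> grind

/-- Edges `np` and `nq` inherit the third vertices of `pq`, and an edge `nr` has only `p` and `q`.
On an old edge, a triangle with apex `n` replaces one that was destroyed, so the number of triangles
does not grow. -/
theorem edge_le_two (h : K.IsEdgeSubdiv L p q n)
    (hK : ∀ v w a b c, K.IsTriangle v w a → K.IsTriangle v w b → K.IsTriangle v w c →
      a = b ∨ a = c ∨ b = c) (v w a b c : V) (ha : L.IsTriangle v w a) (hb : L.IsTriangle v w b)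
    (hc : L.IsTriangle v w c) : a = b ∨ a = c ∨ b = c := by
  have hn' : ∀ z ∈ K.verts, z ≠ n := fun z hz e => h.notMem (e ▸ hz)
  have hT : ∀ x y z, K.IsTriangle x y z → x ≠ n ∧ y ≠ n ∧ z ≠ n ∧ x ≠ y ∧ x ≠ z ∧ y ≠ z :=
    fun x y z h => ⟨hn' _ h.mem_verts, hn' _ h.rotate.mem_verts, hn' _ h.rotate.rotate.mem_verts,
      h.ne⟩
  have hsw : ∀ x y z, K.IsTriangle x y z → K.IsTriangle y x z := fun x y z h => h.swap
  have hnew : ∀ w, (∀ a, L.IsTriangle n w a ↔ (K.IsTriangle p q a ∧ (w = p ∨ w = q)) ∨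
      (K.IsTriangle p q w ∧ (a = p ∨ a = q))) := fun w a => h.isTriangle_iff_new
  have side : ∀ w a b c, L.IsTriangle n w a → L.IsTriangle n w b → L.IsTriangle n w c →
      a = b ∨ a = c ∨ b = c := by
    intro w a b c ha hb hc
    rw [hnew] at ha hb hc
    have := hK p q a b c
    grind
  by_cases hv : v = n
  · subst hv; exact side _ _ _ _ ha hb hc
  by_cases hw : w = n
  · subst hw; exact side _ _ _ _ ha.swap hb.swap hc.swap
  have old : ∀ z, z ≠ n → L.IsTriangle v w z → K.IsTriangle v w z ∧
      ¬ ((v = p ∨ w = p ∨ z = p) ∧ (v = q ∨ w = q ∨ z = q)) := fun z hz h' =>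
    (h.isTriangle_iff hv hw hz).1 h'
  have new : L.IsTriangle v w n → (K.IsTriangle p q w ∧ (v = p ∨ v = q)) ∨
      (K.IsTriangle p q v ∧ (w = p ∨ w = q)) := fun h' => h.isTriangle_iff_new.1 h'.rotate.rotate
  have new' : L.IsTriangle v w n → ∃ z, K.IsTriangle v w z ∧
      ((v = p ∨ w = p ∨ z = p) ∧ (v = q ∨ w = q ∨ z = q)) := by
    intro h'
    rcases new h' with ⟨h1, rfl | rfl⟩ | ⟨h1, rfl | rfl⟩
    · exact ⟨q, h1.swap.rotate, by simp⟩
    · exact ⟨p, h1.rotate, by simp⟩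
    · exact ⟨q, h1.rotate.rotate, by simp⟩
    · exact ⟨p, h1.rotate.swap, by simp⟩
  have := hK v w
  by_cases han : a = n <;> by_cases hbn : b = n <;> by_cases hcn : c = n <;> grind

/-- The link of `p` is the old one with `q` renamed to `n`; predicates are pulled back along this
renaming. -/
theorem link_connected_left (h : K.IsEdgeSubdiv L p q n) (hK : (K.link p).Connected) :
    (L.link p).Connected := by
  have hn' : ∀ z ∈ K.verts, z ≠ n := fun z hz e => h.notMem (e ▸ hz)
  obtain ⟨r, hr⟩ := h.exists_isTriangle
  have hnpr : L.IsTriangle n p r := h.isTriangle_iff_new.2 (Or.inl ⟨hr, Or.inl rfl⟩)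
  rw [link_connected_iff] at hK ⊢
  refine ⟨⟨n, r, hnpr.swap⟩, fun P hP => ?_⟩
  have key := hK.2 (fun w => if w = q then P n else P w) fun a b hT => by
    have ha := hn' _ hT.rotate.mem_verts
    have hb := hn' _ hT.rotate.rotate.mem_verts
    have hne := hT.ne
    by_cases haq : a = q
    · subst haq
      simp only [if_true, if_neg hne.2.2.symm]
      exact hP _ _ (h.isTriangle_iff_new.2 (Or.inl ⟨hT, Or.inl rfl⟩)).swap
    by_cases hbq : b = q
    · subst hbq
      simp only [if_true, if_neg hne.2.2]
      exact hP _ _ (h.isTriangle_iff_new.2 (Or.inl ⟨hT.swap.rotate, Or.inl rfl⟩)).rotate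
    simp only [if_neg haq, if_neg hbq]
    exact hP _ _ (h.isTriangle_of_ne_right hT hr.ne.1 haq hbq)
  have lift : ∀ a b, L.IsTriangle p a b → ∃ a' b', K.IsTriangle p a' b' ∧
      ((if a' = q then P n else P a') ↔ P a) := by
    intro a b hT
    by_cases han : a = n
    · exact ⟨q, r, hr, by simp [han]⟩
    by_cases hbn : b = n
    · subst hbn
      rcases h.isTriangle_iff_new.1 hT.rotate.rotate with ⟨h1, -⟩ | ⟨h1, -⟩
      · exact ⟨a, q, h1.swap.rotate, by rw [if_neg h1.ne.2.2.symm]⟩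
      · exact absurd rfl h1.ne.2.1
    obtain ⟨h1, h2⟩ := (h.isTriangle_iff (hn' _ hr.mem_verts) han hbn).1 hT
    exact ⟨a, b, h1, by rw [if_neg (by tauto)]⟩
  intro a b c d hab hcd hPa
  obtain ⟨a', b', h1, h2⟩ := lift a b hab
  obtain ⟨c', d', h3, h4⟩ := lift c d hcd
  exact h4.1 (key _ _ _ _ h1 h3 (h2.2 hPa))

/-- The link of `n` joins both `p` and `q` to every third vertex `r` of the edge `pq`, and there is
at least one such `r`. -/
theorem link_connected_new (h : K.IsEdgeSubdiv L p q n) : (L.link n).Connected := by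
  obtain ⟨r, hr⟩ := h.exists_isTriangle
  rw [link_connected_iff]
  have hpz : ∀ z, K.IsTriangle p q z → L.IsTriangle n p z := fun z hz =>
    h.isTriangle_iff_new.2 (Or.inl ⟨hz, Or.inl rfl⟩)
  have hqz : ∀ z, K.IsTriangle p q z → L.IsTriangle n q z := fun z hz =>
    h.isTriangle_iff_new.2 (Or.inl ⟨hz, Or.inr rfl⟩)
  refine ⟨⟨p, r, hpz r hr⟩, fun P hP => ?_⟩
  have hP' : ∀ a b, L.IsTriangle n a b → (P a ↔ P b) := fun a b hT =>
    ⟨hP _ _ hT, hP _ _ hT.swap.rotate⟩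
  have h1 := hP' _ _ (hpz r hr)
  have h2 := hP' _ _ (hqz r hr)
  have key : ∀ a b, L.IsTriangle n a b → (P a ↔ P p) := by
    intro a b hT
    rcases h.isTriangle_iff_new.1 hT with ⟨-, rfl | rfl⟩ | ⟨h3, -⟩
    · rfl
    · rw [h2, h1]
    · exact (hP' _ _ (hpz a h3)).symm
  intro a b c d hab hcd
  rw [key a b hab, key c d hcd]
  exact id

/-- If `v` is opposite `pq`, the edge `pq` of its link becomes the path through `n`; otherwise the
link is unchanged. -/
theorem link_connected_of_ne (h : K.IsEdgeSubdiv L p q n) {v : V} (hvp : v ≠ p) (hvq : v ≠ q)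
    (hvn : v ≠ n) (hK : (K.link v).Connected) : (L.link v).Connected := by
  have hn' : ∀ z ∈ K.verts, z ≠ n := fun z hz e => h.notMem (e ▸ hz)
  obtain ⟨r, hr⟩ := h.exists_isTriangle
  rw [link_connected_iff] at hK ⊢
  have hv : v ∈ L.verts := by
    rw [h.verts_eq]; exact Or.inr (mem_verts_iff.2 hK.1)
  refine ⟨mem_verts_iff.1 hv, fun P hP => ?_⟩
  have hP' : ∀ a b, L.IsTriangle v a b → (P a ↔ P b) := fun a b hT =>
    ⟨hP _ _ hT, hP _ _ hT.swap.rotate⟩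
  have hpn : K.IsTriangle p q v → (P p ↔ P n) ∧ (P q ↔ P n) := fun h1 =>
    ⟨(hP' _ _ (h.isTriangle_iff_new.2 (Or.inl ⟨h1, Or.inl rfl⟩)).rotate.rotate).symm,
      (hP' _ _ (h.isTriangle_iff_new.2 (Or.inl ⟨h1, Or.inr rfl⟩)).rotate.rotate).symm⟩
  have key := hK.2 P fun a b hT => by
    by_cases hpq : (v = p ∨ a = p ∨ b = p) ∧ (v = q ∨ a = q ∨ b = q)
    · have h0 := hT.ne
      have h0' := hr.ne
      have h1 := hT.rotate
      have h2 := hT.rotate.swap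
      grind
    · exact hP _ _ ((h.isTriangle_iff hvn (hn' _ hT.rotate.mem_verts)
        (hn' _ hT.rotate.rotate.mem_verts)).2 ⟨hT, hpq⟩)
  have lift : ∀ a b, L.IsTriangle v a b → ∃ a' b', K.IsTriangle v a' b' ∧ (P a' ↔ P a) := by
    intro a b hT
    by_cases han : a = n
    · subst han
      rcases h.isTriangle_iff_new.1 hT.swap with ⟨-, e⟩ | ⟨h1, -⟩
      · grind
      · exact ⟨p, q, h1.rotate.rotate, (hpn h1).1⟩
    by_cases hbn : b = n
    · subst hbn
      rcases h.isTriangle_iff_new.1 hT.rotate.rotate with ⟨-, e⟩ | ⟨h1, rfl | rfl⟩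
      · grind
      · exact ⟨a, q, h1.rotate.rotate, Iff.rfl⟩
      · exact ⟨a, p, h1.rotate.swap, Iff.rfl⟩
    exact ⟨a, b, ((h.isTriangle_iff hvn han hbn).1 hT).1, Iff.rfl⟩
  intro a b c d hab hcd hPa
  obtain ⟨a', b', h1, h2⟩ := lift a b hab
  obtain ⟨c', d', h3, h4⟩ := lift c d hcd
  exact h4.1 (key _ _ _ _ h1 h3 (h2.2 hPa))

theorem isBorderedSurface (h : K.IsEdgeSubdiv L p q n) (hK : K.IsBorderedSurface) :
    L.IsBorderedSurface where
  connected := h.graph_connected hK.connected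
  edge_le_two := forall_ncard_le_two_iff.2
    (h.edge_le_two (forall_ncard_le_two_iff.1 hK.edge_le_two))
  link_connected v hv := by
    obtain ⟨r, hr⟩ := h.exists_isTriangle
    rw [h.verts_eq] at hv
    by_cases hvn : v = n
    · subst hvn; exact h.link_connected_new
    have hv' := hK.link_connected v (hv.resolve_left hvn)
    by_cases hvp : v = p
    · subst hvp; exact h.link_connected_left hv'
    by_cases hvq : v = q
    · subst hvq; exact h.symm.link_connected_left hv'
    exact h.link_connected_of_ne hvp hvq hvn hv'

end IsEdgeSubdiv

end TriComplex

/-! ### Edge subdivision preserves the geometric realization. -/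

namespace TriComplex

variable {V : Type*} [DecidableEq V] {K L : TriComplex V} {p q n : V}

namespace IsEdgeSubdiv

/-- The map that moves the new vertex to the midpoint of the subdivided edge. -/
noncomputable def collapse (p q n : V) (z : V → ℝ) : V → ℝ := fun v =>
  if v = n then 0 else if v = p ∨ v = q then z v + z n / 2 else z v

/-- The map that reads barycentric coordinates in the subdivided complex. -/
noncomputable def refine (p q n : V) (z : V → ℝ) : V → ℝ := fun v =>
  if v = n then 2 * min (z p) (z q)
  else if v = p ∨ v = q then z v - min (z p) (z q) else z v

theorem continuous_collapse : Continuous (collapse p q n) := by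
  refine continuous_pi fun v => ?_
  unfold collapse
  split_ifs <;> fun_prop

theorem continuous_refine : Continuous (refine p q n) := by
  refine continuous_pi fun v => ?_
  unfold refine
  split_ifs <;> fun_prop

theorem ne_of_isTriangle (h : K.IsEdgeSubdiv L p q n) {r : V} (hr : K.IsTriangle p q r) :
    p ≠ q ∧ p ≠ r ∧ q ≠ r ∧ p ≠ n ∧ q ≠ n ∧ r ≠ n := by
  have hn' : ∀ z ∈ K.verts, z ≠ n := fun z hz e => h.notMem (e ▸ hz)
  have := hr.ne
  exact ⟨this.1, this.2.1, this.2.2, hn' _ hr.mem_verts, hn' _ hr.rotate.mem_verts,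
    hn' _ hr.rotate.rotate.mem_verts⟩

theorem eq_zero_of_mem_realization (h : K.IsEdgeSubdiv L p q n) {z : V → ℝ}
    (hz : z ∈ K.realization) : z n = 0 := by
  obtain ⟨-, t, ht, h0, -⟩ := hz
  exact h0 n fun hn => h.notMem ⟨t, ht, hn⟩

/-- No triangle of `L` contains both `p` and `q`. This is what makes `refine` undo `collapse`. -/
theorem min_eq_zero_of_mem_realization (h : K.IsEdgeSubdiv L p q n) {z : V → ℝ}
    (hz : z ∈ L.realization) : min (z p) (z q) = 0 := by
  obtain ⟨hpos, t, ht, h0, -⟩ := hz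
  suffices z p = 0 ∨ z q = 0 by
    rcases this with e | e
    · rw [e, min_eq_left (hpos q)]
    · rw [e, min_eq_right (hpos p)]
  rcases (h.mem_iff t).1 ht with ⟨-, h'⟩ | ⟨r, hr, rfl | rfl⟩
  · by_cases hp : p ∈ t
    · exact Or.inr (h0 q fun hq => h' ⟨hp, hq⟩)
    · exact Or.inl (h0 p hp)
  · have := h.ne_of_isTriangle hr
    exact Or.inr (h0 q (by simp; grind))
  · have := h.ne_of_isTriangle hr
    exact Or.inl (h0 p (by simp; grind))

theorem collapse_eq_self {z : V → ℝ} (hz : z n = 0) : collapse p q n z = z := by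
  funext v
  unfold collapse
  split_ifs with h1
  · rw [h1, hz]
  · rw [hz]; ring
  · rfl

theorem refine_eq_self {z : V → ℝ} (hz : z n = 0) (hm : min (z p) (z q) = 0) :
    refine p q n z = z := by
  funext v
  unfold refine
  split_ifs with h1
  · rw [h1, hz, hm]; ring
  · rw [hm]; ring
  · rfl

theorem collapse_mem (h : K.IsEdgeSubdiv L p q n) {z : V → ℝ} (hz : z ∈ L.realization) :
    collapse p q n z ∈ K.realization := by
  have hz' := hz
  obtain ⟨hpos, t, ht, h0, hs⟩ := hz
  refine ⟨fun v => ?_, ?_⟩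
  · have h1 := hpos v
    have h2 := hpos n
    unfold collapse
    split_ifs <;> linarith
  rcases (h.mem_iff t).1 ht with ⟨ht', -⟩ | ⟨r, hr, rfl | rfl⟩
  · rw [collapse_eq_self (h0 n fun hn => h.notMem ⟨t, ht', hn⟩)]
    exact ⟨t, ht', h0, hs⟩
  · obtain ⟨h1, h2, h3, h4, h5, h6⟩ := h.ne_of_isTriangle hr
    refine ⟨_, hr, fun v hv => ?_, ?_⟩
    · simp only [Finset.mem_insert, Finset.mem_singleton, not_or] at hv
      unfold collapse
      split_ifs with e1 e2
      · rfl
      · tauto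
      · exact h0 v (by simp; tauto)
    · have hq : z q = 0 := h0 q (by simp; grind)
      rw [Finset.sum_insert (by simp; grind), Finset.sum_insert (by simp; grind),
        Finset.sum_singleton] at hs ⊢
      simp only [collapse, h4, h5, h6, h2.symm, h3.symm, if_false, if_true, true_or, or_true,
        or_self, hq]
      linarith
  · obtain ⟨h1, h2, h3, h4, h5, h6⟩ := h.ne_of_isTriangle hr
    refine ⟨_, hr, fun v hv => ?_, ?_⟩
    · simp only [Finset.mem_insert, Finset.mem_singleton, not_or] at hv
      unfold collapse
      split_ifs with e1 e2
      · rfl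
      · tauto
      · exact h0 v (by simp; tauto)
    · have hp : z p = 0 := h0 p (by simp; grind)
      rw [Finset.sum_insert (by simp; grind), Finset.sum_insert (by simp; grind),
        Finset.sum_singleton] at hs ⊢
      simp only [collapse, h4, h5, h6, h2.symm, h3.symm, if_false, if_true, true_or, or_true,
        or_self, hp]
      linarith

theorem refine_mem (h : K.IsEdgeSubdiv L p q n) {z : V → ℝ} (hz : z ∈ K.realization) :
    refine p q n z ∈ L.realization := by
  have hzn := h.eq_zero_of_mem_realization hz
  obtain ⟨hpos, t, ht, h0, hs⟩ := hz
  refine ⟨fun v => ?_, ?_⟩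
  · have h1 := hpos v
    have h2 := le_min (hpos p) (hpos q)
    have h3 := min_le_left (z p) (z q)
    have h4 := min_le_right (z p) (z q)
    unfold refine
    split_ifs with e1 e2
    · linarith
    · rcases e2 with rfl | rfl <;> linarith
    · exact h1
  by_cases hpq : p ∈ t ∧ q ∈ t
  swap
  · have hm : min (z p) (z q) = 0 := by
      by_cases hp : p ∈ t
      · rw [h0 q fun hq => hpq ⟨hp, hq⟩, min_eq_right (hpos p)]
      · rw [h0 p hp, min_eq_left (hpos q)]
    rw [refine_eq_self hzn hm]
    exact ⟨t, (h.mem_iff t).2 (Or.inl ⟨ht, hpq⟩), h0, hs⟩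
  obtain ⟨r₀, hr₀⟩ := h.exists_isTriangle
  obtain ⟨r, hr, rfl⟩ := exists_isTriangle_of_mem ht hpq.1 hpq.2 hr₀.ne.1
  obtain ⟨h1, h2, h3, h4, h5, h6⟩ := h.ne_of_isTriangle hr
  rw [Finset.sum_insert (by simp; grind), Finset.sum_insert (by simp; grind),
    Finset.sum_singleton] at hs
  -- `refine` makes the smaller of the two coordinates vanish, so the point lands in the half
  -- triangle at the other endpoint.
  rcases le_total (z p) (z q) with hle | hle
  · refine ⟨{n, q, r}, (h.mem_iff _).2 (Or.inr ⟨r, hr, Or.inr rfl⟩), fun v hv => ?_, ?_⟩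
    · simp only [Finset.mem_insert, Finset.mem_singleton, not_or] at hv
      by_cases hvp : v = p
      · subst hvp; simp [refine, h4, hle]
      · simp only [refine, hvp, hv, if_false, or_self]
        exact h0 v (by simp; tauto)
    · rw [Finset.sum_insert (by simp; grind), Finset.sum_insert (by simp; grind),
        Finset.sum_singleton]
      simp only [refine, h5, h6, h2.symm, h3.symm, if_false, if_true, or_true, or_self,
        min_eq_left hle]
      linarith
  · refine ⟨{n, p, r}, (h.mem_iff _).2 (Or.inr ⟨r, hr, Or.inl rfl⟩), fun v hv => ?_, ?_⟩
    · simp only [Finset.mem_insert, Finset.mem_singleton, not_or] at hv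
      by_cases hvq : v = q
      · subst hvq; simp [refine, h5, hle]
      · simp only [refine, hvq, hv, if_false, or_self]
        exact h0 v (by simp; tauto)
    · rw [Finset.sum_insert (by simp; grind), Finset.sum_insert (by simp; grind),
        Finset.sum_singleton]
      simp only [refine, h4, h6, h2.symm, h3.symm, if_false, if_true, true_or, or_self,
        min_eq_right hle]
      linarith

/-- Subdividing an edge does not change the geometric realization. -/
noncomputable def realizationHomeomorph (h : K.IsEdgeSubdiv L p q n) :
    L.realization ≃ₜ K.realization where
  toFun z := ⟨collapse p q n z, h.collapse_mem z.2⟩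
  invFun z := ⟨refine p q n z, h.refine_mem z.2⟩
  left_inv z := by
    ext v
    have hm := h.min_eq_zero_of_mem_realization z.2
    obtain ⟨r, hr⟩ := h.exists_isTriangle
    obtain ⟨h1, h2, h3, h4, h5, h6⟩ := h.ne_of_isTriangle hr
    -- Both coordinates grow by `z n / 2`, and their minimum was zero.
    have hm' : min (collapse p q n z p) (collapse p q n z q) = z.1 n / 2 := by
      simp only [collapse, h4, h5, if_false, true_or, or_true, if_true]
      rw [min_add_add_right, hm, zero_add]
    simp only [refine, hm']
    simp only [collapse]
    split_ifs with e1 e2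
    · rw [e1]; ring
    · ring
    · rfl
  right_inv z := by
    ext v
    have hzn := h.eq_zero_of_mem_realization z.2
    simp only [collapse, refine]
    split_ifs with e1 e2
    · rw [e1, hzn]
    · simp
    · rfl
  continuous_toFun := (continuous_collapse.comp continuous_subtype_val).subtype_mk _
  continuous_invFun := (continuous_refine.comp continuous_subtype_val).subtype_mk _

theorem triangulates (h : K.IsEdgeSubdiv L p q n) {S : Type*} [TopologicalSpace S]
    (hK : K.Triangulates S) : L.Triangulates S :=
  ⟨h.isBorderedSurface hK.1, hK.2.map fun e => h.realizationHomeomorph.trans e⟩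

end IsEdgeSubdiv

/-! ### The move as three edge subdivisions. -/

/-- The local barycentric subdivision of an edge `uv` is performed by three subdivisions of edges,
and so preserves triangulations of a surface. -/
theorem exists_localBarycentric {S : Type*} [TopologicalSpace S] (hK : K.Triangulates S)
    {u v x y m b c : V} (hxy : x ≠ y) (hx : K.IsTriangle u v x) (hy : K.IsTriangle u v y)
    (hm : m ∉ K.verts) (hb : b ∉ K.verts) (hc : c ∉ K.verts) (hmb : m ≠ b) (hmc : m ≠ c)
    (hbc : b ≠ c) : ∃ L : TriComplex V, L.Triangulates S ∧
      L.triangles = (K.triangles \ {{u, v, x}, {u, v, y}}) ∪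
        {{u, m, b}, {m, v, b}, {v, x, b}, {x, u, b}, {u, m, c}, {m, v, c}, {v, y, c}, {y, u, c}} := by
  -- Subdivide `uv` at `m`, then `mx` at `b`, then `my` at `c`.
  obtain ⟨K₁, h₁⟩ := exists_isEdgeSubdiv hm ⟨x, hx⟩
  have hmux : K₁.IsTriangle m u x := h₁.isTriangle_iff_new.2 (Or.inl ⟨hx, Or.inl rfl⟩)
  have hmuy : K₁.IsTriangle m u y := h₁.isTriangle_iff_new.2 (Or.inl ⟨hy, Or.inl rfl⟩)
  have hb₁ : b ∉ K₁.verts := by rw [h₁.verts_eq]; simp [hmb.symm, hb]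
  obtain ⟨K₂, h₂⟩ := exists_isEdgeSubdiv hb₁ ⟨u, hmux.swap.rotate⟩
  have hc₂ : c ∉ K₂.verts := by
    rw [h₂.verts_eq, h₁.verts_eq]; simp [hmc.symm, hbc.symm, hc]
  have huvxy : ∀ z ∈ ({u, v, x, y} : Finset V), z ∈ K.verts := by
    simp only [Finset.mem_insert, Finset.mem_singleton]
    rintro z (rfl | rfl | rfl | rfl)
    exacts [hx.mem_verts, hx.rotate.mem_verts, hx.rotate.rotate.mem_verts,
      hy.rotate.rotate.mem_verts]
  have hne : ∀ w, w ∉ K.verts → u ≠ w ∧ v ≠ w ∧ x ≠ w ∧ y ≠ w := fun w hw =>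
    ⟨fun e => hw (e ▸ huvxy u (by simp)), fun e => hw (e ▸ huvxy v (by simp)),
      fun e => hw (e ▸ huvxy x (by simp)), fun e => hw (e ▸ huvxy y (by simp))⟩
  have hnm := hne m hm
  have hnb := hne b hb
  have hnc := hne c hc
  have hnx := hx.ne
  have hny := hy.ne
  have hmuy₂ : K₂.IsTriangle m u y := (h₂.isTriangle_iff hmb hnb.1 hnb.2.2.2).2
    ⟨hmuy, by grind⟩
  obtain ⟨K₃, h₃⟩ := exists_isEdgeSubdiv hc₂ ⟨u, hmuy₂.swap.rotate⟩
  refine ⟨K₃, h₃.triangulates (h₂.triangulates (h₁.triangulates hK)), ?_⟩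
  have h2 := forall_ncard_le_two_iff.1 hK.1.edge_le_two
  have third : ∀ r, K.IsTriangle u v r ↔ r = x ∨ r = y := fun r =>
    ⟨fun hr => by have := h2 u v r x y hr hx hy; tauto, by rintro (rfl | rfl) <;> assumption⟩
  have m₁ : ∀ r s, K₁.IsTriangle m r s ↔ ((s = x ∨ s = y) ∧ (r = u ∨ r = v)) ∨
      ((r = x ∨ r = y) ∧ (s = u ∨ s = v)) := fun r s => by
    rw [h₁.isTriangle_iff_new, third, third]
  have m₂ : ∀ r, K₁.IsTriangle m x r ↔ r = u ∨ r = v := fun r => by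
    rw [m₁]; grind
  -- The second subdivision leaves the triangles on `my` alone: one with apex `b` would need `mxy`
  -- to be a triangle of `K₁`.
  have m₃ : ∀ r, K₂.IsTriangle m y r ↔ r = u ∨ r = v := fun r => by
    by_cases hr : r = b
    · subst hr
      constructor
      · intro h
        have := h₂.isTriangle_iff_new.1 h.rotate.rotate
        rw [m₂, m₂] at this
        grind
      · grind
    · rw [h₂.isTriangle_iff hmb hnb.2.2.2 hr, m₁]; grind
  have e₁ : ∀ t, t ∈ K₁.triangles ↔ (t ∈ K.triangles ∧ ¬ (u ∈ t ∧ v ∈ t)) ∨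
      t = {m, u, x} ∨ t = {m, v, x} ∨ t = {m, u, y} ∨ t = {m, v, y} := fun t => by
    rw [h₁.mem_iff]
    simp only [third]
    refine or_congr_right ⟨?_, ?_⟩
    · rintro ⟨r, rfl | rfl, h | h⟩ <;> simp [h]
    · rintro (h | h | h | h)
      exacts [⟨x, by simp [h]⟩, ⟨x, by simp [h]⟩, ⟨y, by simp [h]⟩, ⟨y, by simp [h]⟩]
  have e₂ : ∀ t, t ∈ K₂.triangles ↔ (t ∈ K₁.triangles ∧ ¬ (m ∈ t ∧ x ∈ t)) ∨
      t = {b, m, u} ∨ t = {b, x, u} ∨ t = {b, m, v} ∨ t = {b, x, v} := fun t => by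
    rw [h₂.mem_iff]
    simp only [m₂]
    refine or_congr_right ⟨?_, ?_⟩
    · rintro ⟨r, rfl | rfl, h | h⟩ <;> simp [h]
    · rintro (h | h | h | h)
      exacts [⟨u, by simp [h]⟩, ⟨u, by simp [h]⟩, ⟨v, by simp [h]⟩, ⟨v, by simp [h]⟩]
  have e₃ : ∀ t, t ∈ K₃.triangles ↔ (t ∈ K₂.triangles ∧ ¬ (m ∈ t ∧ y ∈ t)) ∨
      t = {c, m, u} ∨ t = {c, y, u} ∨ t = {c, m, v} ∨ t = {c, y, v} := fun t => by
    rw [h₃.mem_iff]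
    simp only [m₃]
    refine or_congr_right ⟨?_, ?_⟩
    · rintro ⟨r, rfl | rfl, h | h⟩ <;> simp [h]
    · rintro (h | h | h | h)
      exacts [⟨u, by simp [h]⟩, ⟨u, by simp [h]⟩, ⟨v, by simp [h]⟩, ⟨v, by simp [h]⟩]
  have perm : ∀ r s w : V, ({r, s, w} : Finset V) = {s, r, w} ∧
      ({r, s, w} : Finset V) = {w, r, s} ∧ ({r, s, w} : Finset V) = {w, s, r} := fun r s w => by
    refine ⟨?_, ?_, ?_⟩ <;> (ext z; simp; tauto)
  have hmt : ∀ t ∈ K.triangles, m ∉ t := fun t ht hmt => hm ⟨t, ht, hmt⟩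
  have huv : ∀ t ∈ K.triangles, (u ∈ t ∧ v ∈ t) ↔ (t = {u, v, x} ∨ t = {u, v, y}) := by
    intro t ht
    constructor
    · rintro ⟨hu, hv⟩
      obtain ⟨z, hz, rfl⟩ := exists_isTriangle_of_mem ht hu hv hnx.1
      rcases (third z).1 hz with rfl | rfl <;> simp
    · rintro (rfl | rfl) <;> simp
  ext t
  rw [e₃, e₂, e₁]
  simp only [Finset.mem_union, Finset.mem_sdiff, Finset.mem_insert, Finset.mem_singleton]
  rw [(perm u m b).2.2, (perm m v b).2.1, (perm v x b).2.2, (perm x u b).2.1,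
    (perm u m c).2.2, (perm m v c).2.1, (perm v y c).2.2, (perm y u c).2.1]
  have notMem_b : t = {b, m, u} ∨ t = {b, m, v} ∨ t = {b, x, v} ∨ t = {b, x, u} →
      ¬ (m ∈ t ∧ y ∈ t) := by
    rintro (rfl | rfl | rfl | rfl) <;> simp only [Finset.mem_insert, Finset.mem_singleton] <;>
      grind
  constructor
  · rintro (⟨⟨⟨hK, huvt⟩ | h | h | h | h, hmx⟩ | h, hmy⟩ | h)
    · exact Or.inl ⟨hK, (huv t hK).not.1 huvt⟩
    · exact absurd (by simp [h]) hmx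
    · exact absurd (by simp [h]) hmx
    · exact absurd (by simp [h]) hmy
    · exact absurd (by simp [h]) hmy
    · clear * - h
      tauto
    · clear * - h
      tauto
  · rintro (⟨hK, hn⟩ | h)
    · exact Or.inl ⟨Or.inl ⟨Or.inl ⟨hK, (huv t hK).not.2 hn⟩, fun h => hmt t hK h.1⟩,
        fun h => hmt t hK h.1⟩
    · clear * - h notMem_b
      tauto

end TriComplex

/-! ### Maxwell counts of vertex sets and the choice of an edge. -/

-- Connectedness gives `|W| ≤ |E| + 1`, so the degree sum is at least `2|W| - 2`; it is at most
-- `2|W| - |s|`. Applied to a vertex link, this bounds the number of boundary edges at the vertex.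
open Finset in
theorem SimpleGraph.card_le_two_of_connected {W : Type*} [Fintype W] {G : SimpleGraph W}
    [DecidableRel G.Adj] (hG : G.Connected) (h2 : ∀ w, G.degree w ≤ 2) (s : Finset W)
    (hs : ∀ w ∈ s, G.degree w ≤ 1) : s.card ≤ 2 := by
  classical
  have h1 := hG.card_vert_le_card_edgeSet_add_one
  rw [Nat.card_eq_fintype_card, Nat.card_eq_fintype_card, ← SimpleGraph.edgeFinset_card] at h1
  have h3 := G.sum_degrees_eq_twice_card_edges
  have h4 : ∑ w, (G.degree w + if w ∈ s then 1 else 0) ≤ ∑ _w : W, 2 := by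
    refine sum_le_sum fun w _ => ?_
    split_ifs with hw
    · have := hs w hw; omega
    · exact h2 w
  rw [sum_add_distrib] at h4
  simp at h4
  omega

namespace TriComplex

variable {V : Type*} [DecidableEq V] {K L : TriComplex V}

/-- The vertex set as a finite set. -/
def vertexFinset (K : TriComplex V) : Finset V := K.triangles.biUnion id

theorem mem_vertexFinset {v : V} : v ∈ K.vertexFinset ↔ v ∈ K.verts := by
  simp [vertexFinset, verts]

/-- The edges as unordered pairs. -/
def edgeFinset (K : TriComplex V) : Finset (Sym2 V) :=
  K.triangles.biUnion fun t => t.sym2.filter fun e => ¬ e.IsDiag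

theorem mk_mem_edgeFinset {a b : V} : s(a, b) ∈ K.edgeFinset ↔ K.ambientGraph.Adj a b := by
  simp only [edgeFinset, Finset.mem_biUnion, Finset.mem_filter, Finset.mk_mem_sym2_iff,
    Sym2.mk_isDiag_iff, ambientGraph]
  constructor
  · rintro ⟨t, ht, h, hne⟩; exact ⟨hne, t, ht, h⟩
  · rintro ⟨hne, t, ht, h⟩; exact ⟨t, ht, h, hne⟩

/-- The Maxwell count of the subgraph induced on the vertices in `X`. -/
def inducedCount (K : TriComplex V) (X : Finset V) : ℤ :=
  3 * (X.card : ℤ) - ((K.edgeFinset ∩ X.sym2).card : ℤ)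

theorem inducedCount_vertexFinset : K.inducedCount K.vertexFinset = maxwellCount K.graph := by
  unfold inducedCount maxwellCount
  have h1 : Nat.card K.verts = K.vertexFinset.card := by
    rw [Nat.card_coe_set_eq, ← Set.ncard_coe_finset]
    congr 1; ext v; simp [mem_vertexFinset]
  have h2 : K.graph.edgeSet.ncard = (K.edgeFinset ∩ K.vertexFinset.sym2).card := by
    rw [← Set.ncard_image_of_injective _ (Sym2.map.injective Subtype.val_injective),
      ← Set.ncard_coe_finset]
    congr 1
    ext e
    induction e with | _ a b
    simp only [Finset.coe_inter, Set.mem_inter_iff, Finset.mem_coe, mk_mem_edgeFinset,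
      Finset.mk_mem_sym2_iff, mem_vertexFinset, Set.mem_image]
    constructor
    · rintro ⟨e, he, h⟩
      induction e with | _ c d
      rw [Sym2.map_mk, Sym2.eq_iff] at h
      have hcd : K.ambientGraph.Adj c d := he
      rcases h with ⟨rfl, rfl⟩ | ⟨rfl, rfl⟩
      · exact ⟨hcd, c.2, d.2⟩
      · exact ⟨hcd.symm, d.2, c.2⟩
    · rintro ⟨h, ha, hb⟩
      exact ⟨s(⟨a, ha⟩, ⟨b, hb⟩), h, rfl⟩
  rw [h1, h2]

/-- A subgraph has no more edges than the subgraph induced on its vertices. -/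
theorem isSparse36_of_forall
    (h : ∀ X ⊆ K.vertexFinset, 3 ≤ X.card → 6 ≤ K.inducedCount X) : IsSparse36 K.graph := by
  have hfin : Finite K.verts :=
    Set.Finite.to_subtype (K.vertexFinset.finite_toSet.subset fun v hv => mem_vertexFinset.2 hv)
  refine ⟨hfin, fun G' hG' => ?_⟩
  classical
  have hV : G'.verts.Finite := Set.toFinite _
  have hE : G'.edgeSet.Finite := Set.toFinite _
  set X : Finset V := hV.toFinset.image Subtype.val
  have hX : X.card = G'.verts.ncard := by
    rw [Finset.card_image_of_injective _ Subtype.val_injective, Set.ncard_eq_toFinset_card _ hV]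
  have hle : G'.edgeSet.ncard ≤ (K.edgeFinset ∩ X.sym2).card := by
    rw [← Set.ncard_image_of_injective _ (Sym2.map.injective Subtype.val_injective),
      ← Set.ncard_coe_finset]
    refine Set.ncard_le_ncard ?_ (Finset.finite_toSet _)
    rintro _ ⟨e, he, rfl⟩
    induction e with | _ c d
    have hcd : G'.Adj c d := he
    simp only [Finset.coe_inter, Set.mem_inter_iff, Finset.mem_coe, Sym2.map_mk,
      mk_mem_edgeFinset, Finset.mk_mem_sym2_iff]
    refine ⟨G'.adj_sub hcd, ?_, ?_⟩
    · exact Finset.mem_image.2 ⟨c, by simpa using hcd.fst_mem, rfl⟩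
    · exact Finset.mem_image.2 ⟨d, by simpa using hcd.snd_mem, rfl⟩
  have := h X (fun v hv => by
    obtain ⟨w, -, rfl⟩ := Finset.mem_image.1 hv
    exact mem_vertexFinset.2 w.2) (by omega)
  unfold inducedCount at this
  unfold subgraphMaxwellCount
  omega

theorem le_inducedCount (X : Finset V) :
    3 * (X.card : ℤ) - (X.card.choose 2 : ℤ) ≤ K.inducedCount X := by
  have : (K.edgeFinset ∩ X.sym2).card ≤ X.card.choose 2 := by
    rw [← Sym2.card_image_offDiag]
    refine Finset.card_le_card fun e he => ?_
    induction e with | _ a b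
    simp only [Finset.mem_inter, mk_mem_edgeFinset, Finset.mk_mem_sym2_iff] at he
    exact Finset.mem_image.2 ⟨(a, b), by simp [he.2.1, he.2.2, he.1.ne], rfl⟩
  unfold inducedCount
  omega

/-- A set of vertices that spans only boundary edges induces a graph of maximum degree two. -/
theorem two_mul_card_le_inducedCount (hK : K.IsBorderedSurface) {X : Finset V}
    (hX : X ⊆ K.vertexFinset)
    (hb : ∀ u ∈ X, ∀ v ∈ X, ∀ x y, K.IsTriangle u v x → K.IsTriangle u v y → x = y) :
    2 * (X.card : ℤ) ≤ K.inducedCount X := by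
  classical
  let H : SimpleGraph X := K.ambientGraph.induce (X : Set V)
  have hdeg : ∀ v : X, H.degree v ≤ 2 := by
    intro v
    have hv : (v : V) ∈ K.verts := mem_vertexFinset.1 (hX v.2)
    have hfin : (K.ambientGraph.neighborSet v).Finite :=
      K.vertexFinset.finite_toSet.subset fun w hw => by
        obtain ⟨z, hz⟩ := ambientGraph_adj_iff.1 hw
        exact mem_vertexFinset.2 hz.rotate.mem_verts
    have := hfin.fintype
    have h2 := forall_ncard_le_two_iff.1 hK.edge_le_two
    -- The degree of `w` in the link of `v` is the number of triangles on `vw`: at most two always,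
    -- and at most one for `w` in `X`. So `v` has at most two neighbours in `X`.
    have key := SimpleGraph.card_le_two_of_connected (hK.link_connected v hv) (fun w => by
      by_contra! hc
      obtain ⟨a, ha, b, hb, c, hc, hab, hac, hbc⟩ := Finset.two_lt_card.1 hc
      rw [SimpleGraph.mem_neighborFinset, link_adj_iff] at ha hb hc
      rcases h2 _ _ _ _ _ ha hb hc with e | e | e
      exacts [hab (Subtype.ext e), hac (Subtype.ext e), hbc (Subtype.ext e)])
      (Finset.univ.filter fun w => (w : V) ∈ X) (fun w hw => by
        refine Finset.card_le_one.2 fun a ha b hb' => ?_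
        rw [SimpleGraph.mem_neighborFinset, link_adj_iff] at ha hb'
        exact Subtype.ext (hb _ v.2 _ (Finset.mem_filter.1 hw).2 _ _ ha hb'))
    refine le_trans ?_ key
    rw [← SimpleGraph.card_neighborFinset_eq_degree]
    -- The chosen default only makes the map total; it is never taken on neighbours of `v`.
    refine Finset.card_le_card_of_injOn (fun w => if h : K.ambientGraph.Adj v w then ⟨w, h⟩ else
      Classical.choice (hK.link_connected v hv).nonempty) (fun w hw => ?_) (fun w hw w' hw' e => ?_)
    · have hw' : K.ambientGraph.Adj v w := by simpa [H] using hw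
      simp [hw']
    · have h1 : K.ambientGraph.Adj v w := by simpa [H] using hw
      have h2 : K.ambientGraph.Adj v w' := by simpa [H] using hw'
      simp only [h1, h2, dif_pos] at e
      have e' : (w : V) = w' := Subtype.mk.inj e
      exact Subtype.ext e'
  have hsum := H.sum_degrees_eq_twice_card_edges
  have hle : ∑ v, H.degree v ≤ ∑ _v : X, 2 := Finset.sum_le_sum fun v _ => hdeg v
  have hcard : (K.edgeFinset ∩ X.sym2).card ≤ H.edgeFinset.card := by
    refine le_trans (Finset.card_le_card (t := H.edgeFinset.image (Sym2.map Subtype.val)) ?_)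
      Finset.card_image_le
    intro e he
    induction e with | _ a b
    simp only [Finset.mem_inter, mk_mem_edgeFinset, Finset.mk_mem_sym2_iff] at he
    exact Finset.mem_image.2 ⟨s(⟨a, he.2.1⟩, ⟨b, he.2.2⟩), by
      rw [SimpleGraph.mem_edgeFinset]; exact he.1, rfl⟩
  rw [Finset.sum_const, Finset.card_univ, Fintype.card_coe, smul_eq_mul] at hle
  unfold inducedCount
  omega

/-- A set of vertices with three vertices and small count spans an interior edge whose two triangles
are not both contained in it. -/
theorem exists_interior_edge (hK : K.IsBorderedSurface) {X : Finset V} (hX : X ⊆ K.vertexFinset)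
    (h3 : 3 ≤ X.card) (hlt : K.inducedCount X < 6) (hV : 6 ≤ K.inducedCount K.vertexFinset) :
    ∃ u v x y, x ≠ y ∧ K.IsTriangle u v x ∧ K.IsTriangle u v y ∧ u ∈ X ∧ v ∈ X ∧
      ¬ (x ∈ X ∧ y ∈ X) := by
  by_contra! hcl
  by_cases hb : ∀ u ∈ X, ∀ v ∈ X, ∀ x y, K.IsTriangle u v x → K.IsTriangle u v y → x = y
  · have := two_mul_card_le_inducedCount hK hX hb
    omega
  push Not at hb
  obtain ⟨u, hu, v, hv, x, y, hx, hy, hxy⟩ := hb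
  have hx' := hcl u v x y hxy hx hy hu hv
  -- The property to spread is that `a` is a vertex of a triangle inside `X`; mere membership in `X`
  -- would not pass to neighbours.
  have key := (graph_connected_iff.1 hK.connected).2
    (fun a => a ∈ X ∧ ∃ w w', w ∈ X ∧ w' ∈ X ∧ K.IsTriangle a w w') (by
      rintro a b c hT ⟨ha, w, w', hw, hw', hww⟩
      -- Around `a`, a triangle `a d d'` inside `X` forces the other triangle on `ad` into `X`,
      -- because `hcl` applies to the edge `ad`. Going round the link reaches every triangle at `a`.
      have hl := (link_connected_iff.1 (hK.link_connected a hT.mem_verts)).2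
        (fun w => w ∈ X ∧ ∃ w', w' ∈ X ∧ K.IsTriangle a w w') (by
          rintro d e hde ⟨hd, d', hd', hT'⟩
          refine ⟨?_, d, hd, hde.swap.rotate⟩
          by_cases hed : d' = e
          · exact hed ▸ hd'
          · exact (hcl a d d' e hed hT' hde ha hd).2)
        w w' b c hww hT ⟨hw, w', hw', hww⟩
      obtain ⟨hb, b', hb', hT'⟩ := hl
      exact ⟨hb, a, b', ha, hb', hT'.swap⟩)
  have hall : X = K.vertexFinset := by
    refine hX.antisymm fun a ha => ?_
    exact (key u hx.mem_verts a (mem_vertexFinset.1 ha)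
      ⟨hu, v, x, hv, by by_contra hx2; exact hx2 (hcl u v x y hxy hx hy hu hv).1, hx⟩).1
  rw [hall] at hlt
  omega

end TriComplex

/-! ### Effect of the move on edges and counts. -/

namespace TriComplex

variable {V : Type*} [DecidableEq V] {K L : TriComplex V} {u v x y m b c : V}

/-- `L` arises from `K` by the local barycentric subdivision of the edge `uv`, whose triangles are
`uvx` and `uvy`. -/
structure IsBarycentricMove (K L : TriComplex V) (u v x y m b c : V) : Prop where
  ne : x ≠ y
  left : K.IsTriangle u v x
  right : K.IsTriangle u v y
  eq_or_eq : ∀ r, K.IsTriangle u v r → r = x ∨ r = y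
  m_notMem : m ∉ K.verts
  b_notMem : b ∉ K.verts
  c_notMem : c ∉ K.verts
  m_ne_b : m ≠ b
  m_ne_c : m ≠ c
  b_ne_c : b ≠ c
  triangles_eq : L.triangles = (K.triangles \ {{u, v, x}, {u, v, y}}) ∪
    {{u, m, b}, {m, v, b}, {v, x, b}, {x, u, b}, {u, m, c}, {m, v, c}, {v, y, c}, {y, u, c}}

namespace IsBarycentricMove

theorem localBarycentricMove (h : K.IsBarycentricMove L u v x y m b c) :
    K.LocalBarycentricMove L :=
  ⟨u, v, x, y, m, b, c, h.ne, h.left, h.right, h.m_notMem, h.b_notMem, h.c_notMem, h.m_ne_b,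
    h.m_ne_c, h.b_ne_c, h.triangles_eq⟩

theorem mem_verts (h : K.IsBarycentricMove L u v x y m b c) :
    u ∈ K.verts ∧ v ∈ K.verts ∧ x ∈ K.verts ∧ y ∈ K.verts :=
  ⟨h.left.mem_verts, h.left.rotate.mem_verts, h.left.rotate.rotate.mem_verts,
    h.right.rotate.rotate.mem_verts⟩

theorem distinct (h : K.IsBarycentricMove L u v x y m b c) :
    [u, v, x, y, m, b, c].Nodup := by
  have hne : ∀ z ∈ K.verts, ∀ w, w ∉ K.verts → z ≠ w := fun z hz w hw e => hw (e ▸ hz)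
  obtain ⟨h1, h2, h3, h4⟩ := h.mem_verts
  have := h.left.ne
  have := h.right.ne
  have := h.ne
  have := h.m_ne_b
  have := h.m_ne_c
  have := h.b_ne_c
  have hm := fun z hz => hne z hz m h.m_notMem
  have hb := fun z hz => hne z hz b h.b_notMem
  have hc := fun z hz => hne z hz c h.c_notMem
  have := hm u h1; have := hm v h2; have := hm x h3; have := hm y h4
  have := hb u h1; have := hb v h2; have := hb x h3; have := hb y h4
  have := hc u h1; have := hc v h2; have := hc x h3; have := hc y h4
  clear hne hm hb hc h1 h2 h3 h4 h
  simp
  tauto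

/-- The ten edges that the move creates. -/
def newEdges (u v x y m b c : V) : Finset (Sym2 V) :=
  {s(u, m), s(v, m), s(m, b), s(m, c), s(u, b), s(v, b), s(x, b), s(u, c), s(v, c), s(y, c)}

/-- The outer edges of the two deleted triangles survive in the new triangles at `b` and `c`. Only
`uv` is lost, since by `eq_or_eq` no other triangle contains it. -/
theorem edgeFinset_eq (h : K.IsBarycentricMove L u v x y m b c) :
    L.edgeFinset = K.edgeFinset.erase s(u, v) ∪ newEdges u v x y m b c := by
  have hd := h.distinct
  simp at hd
  ext e
  induction e with | _ p q
  have hmove : ∀ t, t ∈ L.triangles ↔ (t ∈ K.triangles ∧ ¬ (t = {u, v, x} ∨ t = {u, v, y})) ∨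
      t = {u, m, b} ∨ t = {m, v, b} ∨ t = {v, x, b} ∨ t = {x, u, b} ∨ t = {u, m, c} ∨
      t = {m, v, c} ∨ t = {v, y, c} ∨ t = {y, u, c} := by
    intro t
    rw [h.triangles_eq]
    simp only [Finset.mem_union, Finset.mem_sdiff, Finset.mem_insert, Finset.mem_singleton]
  rw [Finset.mem_union, Finset.mem_erase, mk_mem_edgeFinset, mk_mem_edgeFinset]
  have hK : ∀ a b c, K.IsTriangle a b c → K.ambientGraph.Adj a b := fun a b c h =>
    ambientGraph_adj_iff.2 ⟨c, h⟩
  have e1 := hK _ _ _ h.left.rotate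
  have e2 := hK _ _ _ h.left.rotate.rotate
  have e3 := hK _ _ _ h.right.rotate
  have e4 := hK _ _ _ h.right.rotate.rotate
  have e1' := e1.symm
  have e2' := e2.symm
  have e3' := e3.symm
  have e4' := e4.symm
  constructor
  · rintro ⟨hpq, t, ht, hp, hq⟩
    rcases (hmove t).1 ht with ⟨htK, hne⟩ | rfl | rfl | rfl | rfl | rfl | rfl | rfl | rfl
    · refine Or.inl ⟨fun e => hne ?_, hpq, t, htK, hp, hq⟩
      have huv : u ∈ t ∧ v ∈ t := by
        rcases Sym2.eq_iff.1 e with ⟨rfl, rfl⟩ | ⟨rfl, rfl⟩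
        exacts [⟨hp, hq⟩, ⟨hq, hp⟩]
      obtain ⟨z, hz, rfl⟩ := exists_isTriangle_of_mem htK huv.1 huv.2 h.left.ne.1
      rcases h.eq_or_eq z hz with rfl | rfl <;> simp
    all_goals
      simp only [Finset.mem_insert, Finset.mem_singleton] at hp hq
      simp only [newEdges, Finset.mem_insert, Finset.mem_singleton, Sym2.eq_iff, ne_eq]
      clear hmove hK h ht
      rcases hp with rfl | rfl | rfl <;> rcases hq with rfl | rfl | rfl <;> simp_all <;>
        grind
  · have hL : ∀ t ∈ L.triangles, ∀ p ∈ t, ∀ q ∈ t, p ≠ q → L.ambientGraph.Adj p q :=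
      fun t ht p hp q hq hpq => ⟨hpq, t, ht, hp, hq⟩
    have hu1 : ({u, m, b} : Finset V) ∈ L.triangles := (hmove _).2 (by simp)
    have hv1 : ({m, v, b} : Finset V) ∈ L.triangles := (hmove _).2 (by simp)
    have hvx : ({v, x, b} : Finset V) ∈ L.triangles := (hmove _).2 (by simp)
    have hxu : ({x, u, b} : Finset V) ∈ L.triangles := (hmove _).2 (by simp)
    have hu2 : ({u, m, c} : Finset V) ∈ L.triangles := (hmove _).2 (by simp)
    have hv2 : ({m, v, c} : Finset V) ∈ L.triangles := (hmove _).2 (by simp)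
    have hvy : ({v, y, c} : Finset V) ∈ L.triangles := (hmove _).2 (by simp)
    have hyu : ({y, u, c} : Finset V) ∈ L.triangles := (hmove _).2 (by simp)
    rintro (⟨hne, hpq, t, ht, hp, hq⟩ | hN)
    · have hne' : ¬ (p = u ∧ q = v) ∧ ¬ (p = v ∧ q = u) := by
        rw [ne_eq, Sym2.eq_iff] at hne
        tauto
      by_cases hx : t = {u, v, x}
      · rw [hx, Finset.mem_insert, Finset.mem_insert, Finset.mem_singleton] at hp hq
        rcases hp with hp | hp | hp <;> rcases hq with hq | hq | hq <;>
          solve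
          | exact absurd (hp.trans hq.symm) hpq
          | exact (hne'.1 ⟨hp, hq⟩).elim
          | exact (hne'.2 ⟨hp, hq⟩).elim
          | (refine hL _ hvx p ?_ q ?_ hpq <;> simp [hp, hq])
          | (refine hL _ hxu p ?_ q ?_ hpq <;> simp [hp, hq])
      by_cases hy : t = {u, v, y}
      · rw [hy, Finset.mem_insert, Finset.mem_insert, Finset.mem_singleton] at hp hq
        rcases hp with hp | hp | hp <;> rcases hq with hq | hq | hq <;>
          solve
          | exact absurd (hp.trans hq.symm) hpq
          | exact (hne'.1 ⟨hp, hq⟩).elim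
          | exact (hne'.2 ⟨hp, hq⟩).elim
          | (refine hL _ hvy p ?_ q ?_ hpq <;> simp [hp, hq])
          | (refine hL _ hyu p ?_ q ?_ hpq <;> simp [hp, hq])
      exact hL t ((hmove t).2 (Or.inl ⟨ht, by tauto⟩)) p hp q hq hpq
    · rw [← mk_mem_edgeFinset]
      simp only [newEdges, Finset.mem_insert, Finset.mem_singleton] at hN
      rcases hN with e | e | e | e | e | e | e | e | e | e <;> rw [e, mk_mem_edgeFinset]
      exacts [hL _ hu1 _ (by simp) _ (by simp) (by tauto),
        hL _ hv1 _ (by simp) _ (by simp) (by tauto), hL _ hu1 _ (by simp) _ (by simp) (by tauto),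
        hL _ hu2 _ (by simp) _ (by simp) (by tauto), hL _ hu1 _ (by simp) _ (by simp) (by tauto),
        hL _ hv1 _ (by simp) _ (by simp) (by tauto), hL _ hvx _ (by simp) _ (by simp) (by tauto),
        hL _ hu2 _ (by simp) _ (by simp) (by tauto), hL _ hv2 _ (by simp) _ (by simp) (by tauto),
        hL _ hvy _ (by simp) _ (by simp) (by tauto)]

theorem card_newEdges_inter (h : K.IsBarycentricMove L u v x y m b c) (X : Finset V) :
    (newEdges u v x y m b c ∩ X.sym2).card =
      (if u ∈ X ∧ m ∈ X then 1 else 0) + ((if v ∈ X ∧ m ∈ X then 1 else 0) +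
      ((if m ∈ X ∧ b ∈ X then 1 else 0) + ((if m ∈ X ∧ c ∈ X then 1 else 0) +
      ((if u ∈ X ∧ b ∈ X then 1 else 0) + ((if v ∈ X ∧ b ∈ X then 1 else 0) +
      ((if x ∈ X ∧ b ∈ X then 1 else 0) + ((if u ∈ X ∧ c ∈ X then 1 else 0) +
      ((if v ∈ X ∧ c ∈ X then 1 else 0) + (if y ∈ X ∧ c ∈ X then 1 else 0))))))))) := by
  have hd := h.distinct
  simp at hd
  rw [← Finset.filter_mem_eq_inter, Finset.card_filter]
  unfold newEdges
  clear h
  repeat rw [Finset.sum_insert (by simp; grind)]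
  rw [Finset.sum_singleton]
  simp only [Finset.mk_mem_sym2_iff]

/-- The vertices of `X` that are not created by the move. -/
def old (m b c : V) (X : Finset V) : Finset V := X \ {m, b, c}

theorem card_eq (h : K.IsBarycentricMove L u v x y m b c) (X : Finset V) :
    X.card = (old m b c X).card + ((if m ∈ X then 1 else 0) + ((if b ∈ X then 1 else 0) +
      (if c ∈ X then 1 else 0))) := by
  have h1 := h.m_ne_b
  have h2 := h.m_ne_c
  have h3 := h.b_ne_c
  have : (({m, b, c} : Finset V).filter (· ∈ X)).card = (if m ∈ X then 1 else 0) +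
      ((if b ∈ X then 1 else 0) + (if c ∈ X then 1 else 0)) := by
    rw [Finset.card_filter, Finset.sum_insert (by simp [h1, h2]), Finset.sum_insert (by simp [h3]),
      Finset.sum_singleton]
  rw [← this, old, Finset.filter_mem_eq_inter, Finset.inter_comm, Finset.card_sdiff_add_card_inter]

/-- The change of count depends only on which of the seven vertices lie in `X`. Writing it in
Booleans lets `decide` settle the inequalities that follow. -/
theorem inducedCount_eq (h : K.IsBarycentricMove L u v x y m b c) (X : Finset V) :
    L.inducedCount X = K.inducedCount (old m b c X) +
      3 * (((decide (m ∈ X)).toNat + (decide (b ∈ X)).toNat + (decide (c ∈ X)).toNat : ℕ) : ℤ) +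
      ((decide (u ∈ X) && decide (v ∈ X)).toNat : ℤ) -
      (((decide (u ∈ X) && decide (m ∈ X)).toNat + (decide (v ∈ X) && decide (m ∈ X)).toNat +
        (decide (m ∈ X) && decide (b ∈ X)).toNat + (decide (m ∈ X) && decide (c ∈ X)).toNat +
        (decide (u ∈ X) && decide (b ∈ X)).toNat + (decide (v ∈ X) && decide (b ∈ X)).toNat +
        (decide (x ∈ X) && decide (b ∈ X)).toNat + (decide (u ∈ X) && decide (c ∈ X)).toNat +
        (decide (v ∈ X) && decide (c ∈ X)).toNat + (decide (y ∈ X) && decide (c ∈ X)).toNat : ℕ)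
          : ℤ) := by
  have hK : ∀ p q, K.ambientGraph.Adj p q → p ∈ K.verts ∧ q ∈ K.verts := fun p q hpq => by
    obtain ⟨z, hz⟩ := ambientGraph_adj_iff.1 hpq
    exact ⟨hz.mem_verts, hz.rotate.mem_verts⟩
  have hold : K.edgeFinset ∩ X.sym2 = K.edgeFinset ∩ (old m b c X).sym2 := by
    ext e
    induction e with | _ p q
    have h1 := h.m_notMem
    have h2 := h.b_notMem
    have h3 := h.c_notMem
    simp only [Finset.mem_inter, mk_mem_edgeFinset, Finset.mk_mem_sym2_iff, old,
      Finset.mem_sdiff, Finset.mem_insert, Finset.mem_singleton]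
    refine and_congr_right fun hpq => ?_
    have := hK p q hpq
    grind
  have huv : s(u, v) ∈ K.edgeFinset := mk_mem_edgeFinset.2 (ambientGraph_adj_iff.2 ⟨x, h.left⟩)
  have hdisj : Disjoint ((K.edgeFinset.erase s(u, v)) ∩ X.sym2)
      (newEdges u v x y m b c ∩ X.sym2) := by
    rw [Finset.disjoint_left]
    intro e he he'
    have he1 := Finset.mem_of_mem_erase (Finset.mem_inter.1 he).1
    have he2 := (Finset.mem_inter.1 he').1
    have h1 := h.m_notMem
    have h2 := h.b_notMem
    have h3 := h.c_notMem
    simp only [newEdges, Finset.mem_insert, Finset.mem_singleton] at he2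
    rcases he2 with rfl | rfl | rfl | rfl | rfl | rfl | rfl | rfl | rfl | rfl <;>
      have he3 := (hK _ _ (mk_mem_edgeFinset.1 he1)).2
    exacts [h1 he3, h1 he3, h2 he3, h3 he3, h2 he3, h2 he3, h2 he3, h3 he3, h3 he3, h3 he3]
  have hcard : ((K.edgeFinset.erase s(u, v)) ∩ X.sym2).card + (if u ∈ X ∧ v ∈ X then 1 else 0) =
      (K.edgeFinset ∩ (old m b c X).sym2).card := by
    rw [Finset.erase_inter, ← hold]
    split_ifs with huvX
    · exact Finset.card_erase_add_one
        (Finset.mem_inter.2 ⟨huv, Finset.mk_mem_sym2_iff.2 huvX⟩)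
    · rw [Finset.erase_eq_of_notMem fun hmem => huvX
        (Finset.mk_mem_sym2_iff.1 (Finset.mem_inter.1 hmem).2), add_zero]
  have hb : ∀ (P Q : Prop) [Decidable P] [Decidable Q],
      (if P ∧ Q then 1 else 0) = (decide P && decide Q).toNat := by
    intro P Q _ _; by_cases P <;> by_cases Q <;> simp [*]
  have hb' : ∀ (P : Prop) [Decidable P], (if P then 1 else 0) = (decide P).toNat := by
    intro P _; by_cases P <;> simp [*]
  unfold inducedCount
  rw [h.edgeFinset_eq, Finset.union_inter_distrib_right, Finset.card_union_of_disjoint hdisj,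
    h.card_newEdges_inter X, h.card_eq X, ← hcard]
  simp only [hb, hb']
  push_cast
  ring

/-- The right side is the gain in count from new vertices and the lost edge `uv`; the left side is
the cost of the new edges. The equality case drives the termination argument. -/
theorem bool_change : ∀ u v x y m b c : Bool,
    (u && m).toNat + (v && m).toNat + (m && b).toNat + (m && c).toNat + (u && b).toNat +
      (v && b).toNat + (x && b).toNat + (u && c).toNat + (v && c).toNat + (y && c).toNat ≤
        3 * (m.toNat + b.toNat + c.toNat) + (u && v).toNat ∧
    ((u && m).toNat + (v && m).toNat + (m && b).toNat + (m && c).toNat + (u && b).toNat +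
      (v && b).toNat + (x && b).toNat + (u && c).toNat + (v && c).toNat + (y && c).toNat =
        3 * (m.toNat + b.toNat + c.toNat) + (u && v).toNat →
      m = (u && v) ∧ b = (u && v) ∧ c = (u && v) ∧ (u && v) = (u && v && x && y)) := by
  decide

/-- Here `n` is the number of old vertices, assumed pairwise adjacent as the worst case; `Fin 3`
keeps the statement decidable. -/
theorem bool_change_small : ∀ u v x y m b c : Bool, ∀ n : Fin 3,
    u.toNat + v.toNat + x.toNat + y.toNat ≤ n → 3 ≤ n + (m.toNat + (b.toNat + c.toNat)) →
    6 + (n.1.choose 2) + ((u && m).toNat + (v && m).toNat + (m && b).toNat + (m && c).toNat +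
      (u && b).toNat + (v && b).toNat + (x && b).toNat + (u && c).toNat + (v && c).toNat +
      (y && c).toNat) ≤ 3 * n + 3 * (m.toNat + b.toNat + c.toNat) + (u && v).toNat := by
  decide

end IsBarycentricMove

end TriComplex

/-! ### Critical sets and termination. -/

namespace TriComplex

variable {V : Type*} [DecidableEq V] {K L : TriComplex V} {u v x y m b c : V}

namespace IsBarycentricMove

theorem vertexFinset_eq (h : K.IsBarycentricMove L u v x y m b c) :
    L.vertexFinset = K.vertexFinset ∪ {m, b, c} := by
  have hmove : ∀ t, t ∈ L.triangles ↔ (t ∈ K.triangles ∧ ¬ (t = {u, v, x} ∨ t = {u, v, y})) ∨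
      t = {u, m, b} ∨ t = {m, v, b} ∨ t = {v, x, b} ∨ t = {x, u, b} ∨ t = {u, m, c} ∨
      t = {m, v, c} ∨ t = {v, y, c} ∨ t = {y, u, c} := by
    intro t
    rw [h.triangles_eq]
    simp only [Finset.mem_union, Finset.mem_sdiff, Finset.mem_insert, Finset.mem_singleton]
  obtain ⟨hu, hv, hx, hy⟩ := h.mem_verts
  have hL : ∀ t ∈ L.triangles, ∀ p ∈ t, p ∈ L.verts := fun t ht p hp => ⟨t, ht, hp⟩
  have hu1 := hL _ ((hmove {u, m, b}).2 (by simp))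
  have hv1 := hL _ ((hmove {m, v, b}).2 (by simp))
  have hvx := hL _ ((hmove {v, x, b}).2 (by simp))
  have hvy := hL _ ((hmove {v, y, c}).2 (by simp))
  ext p
  simp only [Finset.mem_union, mem_vertexFinset, Finset.mem_insert, Finset.mem_singleton]
  constructor
  · rintro ⟨t, ht, hp⟩
    rcases (hmove t).1 ht with ⟨ht, -⟩ | rfl | rfl | rfl | rfl | rfl | rfl | rfl | rfl
    · exact Or.inl ⟨t, ht, hp⟩
    all_goals
      rw [Finset.mem_insert, Finset.mem_insert, Finset.mem_singleton] at hp
      rcases hp with rfl | rfl | rfl <;> simp [hu, hv, hx, hy]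
  · rintro (⟨t, ht, hp⟩ | rfl | rfl | rfl)
    · by_cases htx : t = {u, v, x}
      · rw [htx, Finset.mem_insert, Finset.mem_insert, Finset.mem_singleton] at hp
        rcases hp with rfl | rfl | rfl
        exacts [hu1 _ (by simp), hv1 _ (by simp), hvx _ (by simp)]
      by_cases hty : t = {u, v, y}
      · rw [hty, Finset.mem_insert, Finset.mem_insert, Finset.mem_singleton] at hp
        rcases hp with rfl | rfl | rfl
        exacts [hu1 _ (by simp), hv1 _ (by simp), hvy _ (by simp)]
      exact hL t ((hmove t).2 (Or.inl ⟨ht, by tauto⟩)) p hp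
    · exact hu1 _ (by simp)
    · exact hu1 _ (by simp)
    · exact hvy _ (by simp)

theorem old_subset (h : K.IsBarycentricMove L u v x y m b c) {X : Finset V}
    (hX : X ⊆ L.vertexFinset) : old m b c X ⊆ K.vertexFinset := by
  rw [h.vertexFinset_eq] at hX
  intro p hp
  rw [old, Finset.mem_sdiff] at hp
  exact (Finset.mem_union.1 (hX hp.1)).resolve_right hp.2

theorem mem_old_iff (h : K.IsBarycentricMove L u v x y m b c) (X : Finset V) :
    (u ∈ old m b c X ↔ u ∈ X) ∧ (v ∈ old m b c X ↔ v ∈ X) ∧ (x ∈ old m b c X ↔ x ∈ X) ∧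
      (y ∈ old m b c X ↔ y ∈ X) := by
  have hd := h.distinct
  simp at hd
  simp only [old, Finset.mem_sdiff, Finset.mem_insert, Finset.mem_singleton]
  tauto

theorem inducedCount_vertexFinset (h : K.IsBarycentricMove L u v x y m b c) :
    L.inducedCount L.vertexFinset = K.inducedCount K.vertexFinset := by
  obtain ⟨hu, hv, hx, hy⟩ := h.mem_verts
  have hold : old m b c L.vertexFinset = K.vertexFinset := by
    rw [old, h.vertexFinset_eq, Finset.union_sdiff_right, Finset.sdiff_eq_self_iff_disjoint,
      Finset.disjoint_right]
    simp [mem_vertexFinset, h.m_notMem, h.b_notMem, h.c_notMem]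
  rw [h.inducedCount_eq, hold]
  have hmem : ∀ p, p ∈ K.verts ∨ p = m ∨ p = b ∨ p = c → p ∈ L.vertexFinset := fun p hp => by
    rw [h.vertexFinset_eq]
    simpa only [Finset.mem_union, mem_vertexFinset, Finset.mem_insert, Finset.mem_singleton] using hp
  simp [hmem, hu, hv, hx, hy]
  ring

theorem inducedCount_old_le (h : K.IsBarycentricMove L u v x y m b c) (X : Finset V) :
    K.inducedCount (old m b c X) ≤ L.inducedCount X := by
  have := (bool_change (decide (u ∈ X)) (decide (v ∈ X)) (decide (x ∈ X)) (decide (y ∈ X))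
    (decide (m ∈ X)) (decide (b ∈ X)) (decide (c ∈ X))).1
  have := h.inducedCount_eq X
  omega

/-- If the move does not increase the count of `X`, then `X` contains the new vertices exactly when
it contains the subdivided edge, in which case it contains its two triangles. -/
theorem of_inducedCount_eq (h : K.IsBarycentricMove L u v x y m b c) {X : Finset V}
    (heq : L.inducedCount X = K.inducedCount (old m b c X)) :
    (m ∈ X ↔ u ∈ X ∧ v ∈ X) ∧ (b ∈ X ↔ u ∈ X ∧ v ∈ X) ∧ (c ∈ X ↔ u ∈ X ∧ v ∈ X) ∧
      (u ∈ X ∧ v ∈ X → x ∈ X ∧ y ∈ X) := by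
  have h1 := (bool_change (decide (u ∈ X)) (decide (v ∈ X)) (decide (x ∈ X)) (decide (y ∈ X))
    (decide (m ∈ X)) (decide (b ∈ X)) (decide (c ∈ X))).2 (by
      have := h.inducedCount_eq X
      omega)
  simp only [← Bool.decide_and, decide_eq_decide] at h1
  tauto

/-- The lower bound assumed for `K` says nothing about an old part with fewer than three vertices,
so such sets are checked directly. -/
theorem six_le_inducedCount (h : K.IsBarycentricMove L u v x y m b c) {X : Finset V}
    (h3 : 3 ≤ X.card) (hold : (old m b c X).card < 3) : 6 ≤ L.inducedCount X := by
  have hd := h.distinct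
  simp at hd
  have huvxy : (decide (u ∈ X)).toNat + (decide (v ∈ X)).toNat + (decide (x ∈ X)).toNat +
      (decide (y ∈ X)).toNat ≤ (old m b c X).card := by
    have hsub : ({u, v, x, y} : Finset V).filter (· ∈ X) ⊆ old m b c X := by
      intro p hp
      obtain ⟨hp, hpX⟩ := Finset.mem_filter.1 hp
      simp only [Finset.mem_insert, Finset.mem_singleton] at hp
      rcases hp with rfl | rfl | rfl | rfl
      exacts [(h.mem_old_iff X).1.2 hpX, (h.mem_old_iff X).2.1.2 hpX,
        (h.mem_old_iff X).2.2.1.2 hpX, (h.mem_old_iff X).2.2.2.2 hpX]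
    refine le_trans (le_of_eq ?_) (Finset.card_le_card hsub)
    rw [Finset.card_filter, Finset.sum_insert (by simp; tauto), Finset.sum_insert (by simp; tauto),
      Finset.sum_insert (by simp; tauto), Finset.sum_singleton]
    simp only [Bool.toNat, Bool.cond_decide]
    ring
  have hcard := h.card_eq X
  have key := bool_change_small (decide (u ∈ X)) (decide (v ∈ X)) (decide (x ∈ X))
    (decide (y ∈ X)) (decide (m ∈ X)) (decide (b ∈ X)) (decide (c ∈ X)) ⟨_, hold⟩ huvxy (by
      simp only [Bool.toNat, Bool.cond_decide]
      omega)
  have h1 := h.inducedCount_eq X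
  have h2 := K.le_inducedCount (old m b c X)
  simp only at key
  omega

end IsBarycentricMove

/-- The sets of at least three vertices whose induced subgraphs have count `k`. -/
def criticalSets (K : TriComplex V) (k : ℤ) : Finset (Finset V) :=
  K.vertexFinset.powerset.filter fun X => 3 ≤ X.card ∧ K.inducedCount X = k

theorem mem_criticalSets {k : ℤ} {X : Finset V} :
    X ∈ K.criticalSets k ↔ X ⊆ K.vertexFinset ∧ 3 ≤ X.card ∧ K.inducedCount X = k := by
  simp [criticalSets]

theorem IsBarycentricMove.le_inducedCount (h : K.IsBarycentricMove L u v x y m b c) {k : ℤ}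
    (hk : k < 6) (hK : ∀ X ⊆ K.vertexFinset, 3 ≤ X.card → k ≤ K.inducedCount X) (X : Finset V)
    (hX : X ⊆ L.vertexFinset) (h3 : 3 ≤ X.card) : k ≤ L.inducedCount X := by
  by_cases hold : 3 ≤ (old m b c X).card
  · exact (hK _ (h.old_subset hX) hold).trans (h.inducedCount_old_le X)
  · exact hk.le.trans (h.six_le_inducedCount h3 (by omega))

theorem IsBarycentricMove.card_criticalSets_lt (h : K.IsBarycentricMove L u v x y m b c) {k : ℤ}
    (hk : k < 6) (hK : ∀ X ⊆ K.vertexFinset, 3 ≤ X.card → k ≤ K.inducedCount X) {X₀ : Finset V}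
    (hX₀ : X₀ ∈ K.criticalSets k) (hu : u ∈ X₀) (hv : v ∈ X₀) (hxy : ¬ (x ∈ X₀ ∧ y ∈ X₀)) :
    (L.criticalSets k).card < (K.criticalSets k).card := by
  have key : ∀ X ∈ L.criticalSets k, 3 ≤ (old m b c X).card ∧
      L.inducedCount X = K.inducedCount (old m b c X) := by
    intro X hX
    obtain ⟨hX, h3, hXk⟩ := mem_criticalSets.1 hX
    have hold : 3 ≤ (old m b c X).card := by
      by_contra! hlt
      have := h.six_le_inducedCount h3 hlt
      omega
    have h1 := hK _ (h.old_subset hX) hold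
    have h2 := h.inducedCount_old_le X
    exact ⟨hold, by omega⟩
  refine lt_of_le_of_lt (Finset.card_le_card_of_injOn (t := (K.criticalSets k).erase X₀)
    (old m b c) (fun X hX => ?_) (fun X hX Y hY hXY => ?_)) (Finset.card_erase_lt_of_mem hX₀)
  · obtain ⟨h3, heq⟩ := key X hX
    have hX' := mem_criticalSets.1 hX
    refine Finset.mem_coe.2 (Finset.mem_erase.2 ⟨?_, mem_criticalSets.2
      ⟨h.old_subset hX'.1, h3, by omega⟩⟩)
    -- `X₀` is not an old part: it contains `u` and `v`, so the equality case would put `x` and `y`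
    -- in it.
    rintro rfl
    obtain ⟨h1, h2, h3, h4⟩ := h.mem_old_iff X
    obtain ⟨hx, hy⟩ := (h.of_inducedCount_eq heq).2.2.2 ⟨h1.1 hu, h2.1 hv⟩
    exact hxy ⟨h3.2 hx, h4.2 hy⟩
  -- Injectivity: in the equality case membership of `m`, `b`, `c` is dictated by that of `u` and
  -- `v`, which the old part records.
  · have hX1 := h.of_inducedCount_eq (key X hX).2
    have hY1 := h.of_inducedCount_eq (key Y hY).2
    have hX2 := h.mem_old_iff X
    have hY2 := h.mem_old_iff Y
    rw [hXY] at hX2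
    have huX : u ∈ X ↔ u ∈ Y := hX2.1.symm.trans hY2.1
    have hvX : v ∈ X ↔ v ∈ Y := hX2.2.1.symm.trans hY2.2.1
    have hmX : m ∈ X ↔ m ∈ Y := by rw [hX1.1, hY1.1, huX, hvX]
    have hbX : b ∈ X ↔ b ∈ Y := by rw [hX1.2.1, hY1.2.1, huX, hvX]
    have hcX : c ∈ X ↔ c ∈ Y := by rw [hX1.2.2.1, hY1.2.2.1, huX, hvX]
    ext p
    have hp : p ∈ old m b c X ↔ p ∈ old m b c Y := by rw [hXY]
    simp only [old, Finset.mem_sdiff, Finset.mem_insert, Finset.mem_singleton] at hp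
    clear hX hY hX1 hY1 hX2 hY2 hXY
    by_cases hpm : p = m
    · rw [hpm, hmX]
    by_cases hpb : p = b
    · rw [hpb, hbX]
    by_cases hpc : p = c
    · rw [hpc, hcX]
    simpa only [hpm, hpb, hpc, or_self, not_false_eq_true, and_true] using hp

theorem exists_isBarycentricMove [Infinite V] {S : Type*} [TopologicalSpace S]
    (hK : K.Triangulates S) (hxy : x ≠ y) (hx : K.IsTriangle u v x) (hy : K.IsTriangle u v y) :
    ∃ (m b c : V) (L : TriComplex V), K.IsBarycentricMove L u v x y m b c ∧ L.Triangulates S := by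
  obtain ⟨m, hm⟩ := Infinite.exists_notMem_finset K.vertexFinset
  obtain ⟨b, hb⟩ := Infinite.exists_notMem_finset (insert m K.vertexFinset)
  obtain ⟨c, hc⟩ := Infinite.exists_notMem_finset (insert b (insert m K.vertexFinset))
  simp only [Finset.mem_insert, not_or, mem_vertexFinset] at hm hb hc
  obtain ⟨L, hL, hLt⟩ := exists_localBarycentric hK hxy hx hy hm hb.2 hc.2.2 (Ne.symm hb.1)
    (Ne.symm hc.2.1) (Ne.symm hc.1)
  refine ⟨m, b, c, L, ⟨hxy, hx, hy, fun r hr => ?_, hm, hb.2, hc.2.2, Ne.symm hb.1,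
    Ne.symm hc.2.1, Ne.symm hc.1, hLt⟩, hL⟩
  have := forall_ncard_le_two_iff.1 hK.1.edge_le_two u v r x y hr hx hy
  tauto

/-- Some sequence of moves removes all sets of small count. -/
theorem exists_reflTransGen [Infinite V] {S : Type*} [TopologicalSpace S] (d N : ℕ) :
    ∀ K : TriComplex V, K.Triangulates S → K.inducedCount K.vertexFinset = 6 →
      (∀ X ⊆ K.vertexFinset, 3 ≤ X.card → 6 - (d : ℤ) ≤ K.inducedCount X) →
      (K.criticalSets (6 - d)).card = N →
      ∃ L : TriComplex V, Relation.ReflTransGen LocalBarycentricMove K L ∧ L.Triangulates S ∧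
        L.inducedCount L.vertexFinset = 6 ∧
        ∀ X ⊆ L.vertexFinset, 3 ≤ X.card → 6 ≤ L.inducedCount X := by
  -- Lexicographic descent: `d` is how far the lower bound may fall below 6, and `N` is the number
  -- of sets attaining that bound.
  induction d generalizing N with
  | zero =>
    intro K hK h6 hmin _
    exact ⟨K, .refl, hK, h6, by simpa using hmin⟩
  | succ d ihd =>
    induction N using Nat.strong_induction_on with
    | _ N ihN =>
    intro K hK h6 hmin hN
    rcases (K.criticalSets (6 - (d + 1 : ℕ))).eq_empty_or_nonempty with hemp | ⟨X₀, hX₀⟩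
    · refine ihd _ K hK h6 (fun X hX h3 => ?_) rfl
      have h1 := hmin X hX h3
      have h2 : K.inducedCount X ≠ 6 - (d + 1 : ℕ) := fun e => by
        have := mem_criticalSets.2 ⟨hX, h3, e⟩
        rw [hemp] at this
        exact absurd this (Finset.notMem_empty _)
      push_cast at h1 h2
      omega
    · have hk : (6 : ℤ) - (d + 1 : ℕ) < 6 := by push_cast; omega
      obtain ⟨hX, h3, hcount⟩ := mem_criticalSets.1 hX₀
      obtain ⟨u, v, x, y, hxy, hx, hy, hu, hv, hdiam⟩ :=
        exists_interior_edge hK.1 hX h3 (by omega) h6.ge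
      obtain ⟨m, b, c, L, hL, hLt⟩ := exists_isBarycentricMove hK hxy hx hy
      obtain ⟨M, hM, hM'⟩ := ihN _ (hN ▸ hL.card_criticalSets_lt hk hmin hX₀ hu hv hdiam) L hLt
        (hL.inducedCount_vertexFinset.trans h6) (hL.le_inducedCount hk hmin) rfl
      exact ⟨M, .head hL.localBarycentricMove hM, hM'⟩

end TriComplex

theorem Relation.ReflTransGen.exists_seq {α : Type*} {r : α → α → Prop} {a b : α}
    (h : Relation.ReflTransGen r a b) :
    ∃ (n : ℕ) (f : ℕ → α), f 0 = a ∧ f n = b ∧ ∀ i < n, r (f i) (f (i + 1)) := by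
  induction h using Relation.ReflTransGen.head_induction_on with
  | refl => exact ⟨0, fun _ => b, rfl, rfl, by simp⟩
  | @head a c hac _ ih =>
    obtain ⟨n, f, h0, hn, hf⟩ := ih
    refine ⟨n + 1, fun i => Nat.casesOn i a f, rfl, hn, fun i hi => ?_⟩
    cases i with
    | zero => simpa [h0] using hac
    | succ i => exact hf i (by omega)

theorem mainTheorem8 {V : Type*} [DecidableEq V] [Infinite V]
    {S : Type*} [TopologicalSpace S] [T2Space S] [CompactSpace S] [ConnectedSpace S]
    [ChartedSpace (EuclideanHalfSpace 2) S]
    (G : TriComplex V) (hG : G.Triangulates S) (hf : maxwellCount G.graph = 6) :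
    ∃ (n : ℕ) (H : ℕ → TriComplex V),
      H 0 = G ∧ (∀ i < n, (H i).LocalBarycentricMove (H (i + 1))) ∧
      (H n).Triangulates S ∧ IsTight36 (H n).graph := by
  -- No count is below `-|E|`, so `6 + |E|` is a valid initial deficit.
  obtain ⟨L, hGL, hL, hL6, hLs⟩ := TriComplex.exists_reflTransGen (6 + G.edgeFinset.card) _ G hG
    (TriComplex.inducedCount_vertexFinset.trans hf) (fun X _ _ => by
      have : (G.edgeFinset ∩ X.sym2).card ≤ G.edgeFinset.card :=
        Finset.card_le_card Finset.inter_subset_left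
      unfold TriComplex.inducedCount
      push_cast
      omega) rfl
  obtain ⟨n, H, h0, hn, hH⟩ := hGL.exists_seq
  refine ⟨n, H, h0, hH, hn ▸ hL, ?_⟩
  rw [hn]
  exact ⟨TriComplex.isSparse36_of_forall hLs, TriComplex.inducedCount_vertexFinset.symm.trans hL6⟩
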